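/- For a complex tensor $A$ of order $d$ and dimension $n$ (all $d$ indices in $[n]=\{1,\dots,n\}$) let \[ \operatorname{per}(A)=\sum_{\sigma_2,\dots,\sigma_d\in S_n}\ \prod_{i=1}^n a_{i\,\sigma_2(i)\cdots\sigma_d(i)} . \] For $\mu\in\mathbb C$, let $\mathcal D_\mu$ denote any probability distribution on $\mathbb C$ with mean $\mu$, variance $\mathbb E|x-\mu|^2=1$ and finite third moment $\mathbb E|x-\mu|^3<\infty$, and let $\mathscr T_{d,n,\mu}$ be the law of a random tensor of order $d$ and dimension $n$ with i.i.d. entries drawn from $\mathcal D_\mu$. Let $c\in(0,1/8)$. There is a deterministic algorithm which, given a complex tensor $R$ of order $d\ge 3$ and dimension $n\ge 1$ and a real number $\varepsilon\in(0,1)$, computes a complex number $\mathcal P(R,\varepsilon)$, and which is a PTAS for $\operatorname{per}(R)$ for random $R$ with $d=O(\operatorname{polylog} n)$, in the following sense. Let $C\in\mathbb R$ and let $\kappa\ge 0$ be an integer, and consider orders $d$ with $3\le d\le C(1+\ln n)^\kappa$. (1) There is a $K\in\mathbb N$, depending only on $c,C,\kappa$, such that for all such $d,n$, every input tensor $R$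 and every $\varepsilon\in(0,1)$, the running time is at most $K\,n^K\exp(\varepsilon^{-K})$. In particular, it is polynomial in $n$ for every fixed $\varepsilon$. (2) For every $M$ there is a sequence $\delta(n)\to 0$ as $n\to\infty$, depending only on $c,C,\kappa,M$, such that for all such $d,n$, every $\mu\in\mathbb C$ with $|\mu|\ge\left(\frac{\ln n}{(d-1)^6}\right)^{-c}$ (no condition if $n=1$), every $\mathcal D_\mu$ with $\mathbb E|x-\mu|^3\le M$ and every $\varepsilon\in(0,1)$, \[ \Pr_{R\sim\mathscr T_{d,n,\mu}}\left(\operatorname{per}(R)\ne 0\ \text{ and }\ \left|1-\frac{\mathcal P(R,\varepsilon)}{\operatorname{per}(R)}\right|\le\varepsilon\right)\ \ge\ 1-\delta(n). \] Here an algorithm is one fixed program for a unit-cost random access machine over the reals: complex registers with exact $+,-,\times,/$ (with $x/0=0$), real and imaginary parts and comparison of real parts; integer registers with addition, truncated subtraction and comparison; indirect addressing; integers may be copied to complex registers; no rounding, and no constants other than integers and the imaginary unit. The input consists of $n$, $d$, $\varepsilon$ and the entries of $R$; the running time is the number of instructions and tests executed. -/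

import Mathlib

open MeasureTheory Filter Topology

namespace TensorPermanent

/-- Complex tensors of order `d` and dimension `n` (all `d` indices range over `Fin n`). -/
abbrev Tensor (d n : ℕ) : Type := (Fin d → Fin n) → ℂ

/-- The permanent `∑ ∏ i, A (i, σ₂ i, …, σ_d i)`, the sum being over all `(σ₂, …, σ_d)` in `(S_n)^(d-1)`:
these tuples are encoded as `(σ₁, …, σ_d)` with `σ₁ = 1`. -/
noncomputable def per {d n : ℕ} (A : Tensor d n) : ℂ :=
  ∑ σ : Fin d → Equiv.Perm (Fin n) with ∀ k, k.val = 0 → σ k = 1,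
    ∏ i : Fin n, A (fun k => σ k i)

/-- `ν` is an entry distribution with mean `μ`: a probability distribution on `ℂ` with mean `μ`,
variance `1` and finite third absolute moment. -/
structure IsEntryDistribution (μ : ℂ) (ν : Measure ℂ) : Prop where
  isProbabilityMeasure : IsProbabilityMeasure ν
  memLp : MemLp (fun x : ℂ => x) 3 ν
  mean : ∫ x, x ∂ν = μ
  variance : ∫ x, ‖x - μ‖ ^ 2 ∂ν = 1

/-- The law of a random tensor whose `n ^ d` entries are i.i.d. with law `ν`. -/
noncomputable def tensorDistribution (ν : Measure ℂ) (d n : ℕ) : Measure (Tensor d n) :=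
  Measure.pi fun _ => ν

/-! ### The machine model

A unit-cost random access machine over the real numbers. It has an unbounded memory `int` of natural
numbers, with addition and truncated subtraction, and an unbounded memory `num` of complex numbers
(pairs of reals), with the exact field operations and real and imaginary parts. Both memories
allow direct and indirect addressing. The entries of the input tensor sit in a read-only input array.
There is no rounding and no conversion from complex numbers to integers. -/

/-- The contents of the two memories. -/
structure Store where
  int : ℕ → ℕ
  num : ℕ → ℂ

namespace Store

/-- Write `v` to the integer register `r`. -/
def setInt (s : Store) (r v : ℕ) : Store := { s with int := Function.update s.int r v }

/-- Write `v` to the numerical register `r`. -/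
noncomputable def setNum (s : Store) (r : ℕ) (v : ℂ) : Store :=
  { s with num := Function.update s.num r v }

end Store

/-- The instructions; all arguments except the constant `k` in `intConst` are register numbers. -/
inductive Instr : Type
  | intConst (r k : ℕ)
  | intAdd (r a b : ℕ)
  | intSub (r a b : ℕ)
  | intLoad (r a : ℕ)
  | intStore (a b : ℕ)
  | numOfInt (r a : ℕ)
  | numI (r : ℕ)
  | numAdd (r a b : ℕ)
  | numSub (r a b : ℕ)
  | numMul (r a b : ℕ)
  | numDiv (r a b : ℕ)
  | numRe (r a : ℕ)
  | numIm (r a : ℕ)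
  | numLoad (r a : ℕ)
  | numStore (a b : ℕ)
  | numRead (r a : ℕ)

/-- The effect of one instruction, where `x` is the read-only input array. The instruction
`numRead r a` copies the input entry whose address is in the integer register `a`. -/
noncomputable def Instr.exec (x : ℕ → ℂ) (s : Store) : Instr → Store
  | .intConst r k => s.setInt r k
  | .intAdd r a b => s.setInt r (s.int a + s.int b)
  | .intSub r a b => s.setInt r (s.int a - s.int b)
  | .intLoad r a => s.setInt r (s.int (s.int a))
  | .intStore a b => s.setInt (s.int a) (s.int b)
  | .numOfInt r a => s.setNum r (s.int a : ℂ)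
  | .numI r => s.setNum r Complex.I
  | .numAdd r a b => s.setNum r (s.num a + s.num b)
  | .numSub r a b => s.setNum r (s.num a - s.num b)
  | .numMul r a b => s.setNum r (s.num a * s.num b)
  | .numDiv r a b => s.setNum r (s.num a / s.num b)
  | .numRe r a => s.setNum r ((s.num a).re : ℂ)
  | .numIm r a => s.setNum r ((s.num a).im : ℂ)
  | .numLoad r a => s.setNum r (s.num (s.int a))
  | .numStore a b => s.setNum (s.int a) (s.num b)
  | .numRead r a => s.setNum r (x (s.int a))

/-- Branching conditions: comparison of two integer registers, or of the real parts of two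
numerical registers. -/
inductive Test : Type
  | intLe (a b : ℕ)
  | numLe (a b : ℕ)

/-- Truth of a branching condition. -/
def Test.Holds (s : Store) : Test → Prop
  | .intLe a b => s.int a ≤ s.int b
  | .numLe a b => (s.num a).re ≤ (s.num b).re

/-- Programs. A program is a finite object that does not depend on the input. -/
inductive Prog : Type
  | skip
  | instr (i : Instr)
  | seq (p q : Prog)
  | cond (b : Test) (p q : Prog)
  | loop (b : Test) (p : Prog)

/-- `Runs x p s T u`: on the input array `x`, the program `p` started in the store `s` halts in the
store `u` after exactly `T` steps. Every instruction and every evaluation of a test is one step;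
`loop b p` is the loop "while `b` do `p`". -/
inductive Prog.Runs (x : ℕ → ℂ) : Prog → Store → ℕ → Store → Prop
  | skip (s : Store) : Runs x .skip s 1 s
  | instr (i : Instr) (s : Store) : Runs x (.instr i) s 1 (i.exec x s)
  | seq {p q : Prog} {s u v : Store} {T T₂ : ℕ} :
      Runs x p s T u → Runs x q u T₂ v → Runs x (.seq p q) s (T + T₂) v
  | condTrue {b : Test} {p q : Prog} {s u : Store} {T : ℕ} :
      b.Holds s → Runs x p s T u → Runs x (.cond b p q) s (1 + T) u
  | condFalse {b : Test} {p q : Prog} {s u : Store} {T : ℕ} :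
      ¬ b.Holds s → Runs x q s T u → Runs x (.cond b p q) s (1 + T) u
  | loopTrue {b : Test} {p : Prog} {s u v : Store} {T T₂ : ℕ} :
      b.Holds s → Runs x p s T u → Runs x (.loop b p) u T₂ v → Runs x (.loop b p) s (1 + T + T₂) v
  | loopFalse {b : Test} {p : Prog} {s : Store} :
      ¬ b.Holds s → Runs x (.loop b p) s 1 s

/-- The machine is deterministic: the running time and the final store are determined by the input. -/
theorem Prog.Runs.deterministic {x : ℕ → ℂ} {p : Prog} {s u v : Store} {T T₂ : ℕ}
    (h : Prog.Runs x p s T u) (h₂ : Prog.Runs x p s T₂ v) : T = T₂ ∧ u = v := by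
  induction h generalizing T₂ v with
  | skip s => cases h₂; exact ⟨rfl, rfl⟩
  | instr i s => cases h₂; exact ⟨rfl, rfl⟩
  | seq _ _ ih1 ih2 =>
    cases h₂ with
    | seq k1 k2 =>
      obtain ⟨rfl, rfl⟩ := ih1 k1
      obtain ⟨rfl, rfl⟩ := ih2 k2
      exact ⟨rfl, rfl⟩
  | condTrue hb _ ih =>
    cases h₂ with
    | condTrue _ k => obtain ⟨rfl, rfl⟩ := ih k; exact ⟨rfl, rfl⟩
    | condFalse hn _ => exact absurd hb hn
  | condFalse hn _ ih =>
    cases h₂ with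
    | condTrue hb _ => exact absurd hb hn
    | condFalse _ k => obtain ⟨rfl, rfl⟩ := ih k; exact ⟨rfl, rfl⟩
  | loopTrue hb _ _ ih1 ih2 =>
    cases h₂ with
    | loopTrue _ k1 k2 =>
      obtain ⟨rfl, rfl⟩ := ih1 k1
      obtain ⟨rfl, rfl⟩ := ih2 k2
      exact ⟨rfl, rfl⟩
    | loopFalse hn => exact absurd hb hn
  | loopFalse hn =>
    cases h₂ with
    | loopTrue hb _ _ => exact absurd hb hn
    | loopFalse _ => exact ⟨rfl, rfl⟩

/-- The input array of a tensor: the entry with index `i` has address `∑ k, i k * n ^ k`. -/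
def inputArray {d n : ℕ} (A : Tensor d n) (a : ℕ) : ℂ :=
  if h : a < n ^ d then A (finFunctionFinEquiv.symm ⟨a, h⟩) else 0

/-- The initial store: `n` and `d` in integer registers `0` and `1`, `ε` in numerical register `0`,
and zeros elsewhere. -/
noncomputable def initStore (d n : ℕ) (ε : ℝ) : Store where
  int := fun r => if r = 0 then n else if r = 1 then d else 0
  num := fun r => if r = 0 then (ε : ℂ) else 0

/-- On input `(A, ε)` the program `p` halts after exactly `T` steps with output `y`, the final content
of numerical register `0`. -/
def Prog.Computes (p : Prog) {d n : ℕ} (A : Tensor d n) (ε : ℝ) (T : ℕ) (y : ℂ) : Prop :=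
  ∃ u : Store, Prog.Runs (inputArray A) p (initStore d n ε) T u ∧ u.num 0 = y

end TensorPermanent

namespace TensorPermanent

open scoped ComplexConjugate

/-! ### Second moments of sums of products of independent entries -/

/-! For order at least 3 the permanent of a random tensor is concentrated so sharply that a
first-order estimate suffices. Dividing all entries by `μ` turns each summand of the permanent into
a product with expectation 1, and two summands that share `m` positions have mixed second moment `(1
+ w) ^ m` with `w = ‖μ‖⁻²`. Two random tuples of permutations share on average `n ^ (2 - d) ≤ 1 / n`
positions, and a binomial expansion makes this quantitative: the variance of `per R / (μ ^ n * n! ^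
(d - 1))` is at most `exp w / n` (`sum_sum_permTuples_le`, `IsEntryDistribution.per_concentration`).
The lower bound on `‖μ‖` gives `w ≤ log n / 4` once `n ≥ exp 7` (`inv_norm_sq_le`), hence a variance
of at most `n ^ (-3/4)`.

The mean `μ` is not part of the input, so it is replaced by the average of `n ^ 3 ≤ n ^ d` entries.
The relative error of that average has variance `w / n ^ 3`, small enough to survive the `n`-th
power (`IsEntryDistribution.average_concentration`, `norm_pow_sub_one_le`).

Chebyshev's inequality gives a failure bound uniform in `ε` only as long as `ε` is not too small
compared with `n`. For `ε ^ 4 * n ≥ 1` the failure probability is `O(n ^ (-1/4))`. Otherwise `n <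
ε⁻⁴`, and exhaustive search, whose cost is exponential in a power of `n`, fits into `exp (ε ^ (-K))`
(`exists_time_bound`).

The rest implements both branches on the machine. Programs are treated as expression evaluators over
two register stacks: a program placed at levels `a` and `b` preserves everything below these levels,
so nested loops compose without further bookkeeping (`halts_forProg`, `permanentProg_computes`). -/

theorem integral_sub_sub_sub {α : Type*} [MeasurableSpace α] {m : Measure α} {f g k l : α → ℂ}
    (hf : Integrable f m) (hg : Integrable g m) (hk : Integrable k m) (hl : Integrable l m) :
    ∫ x, f x - g x - (k x - l x) ∂m =
      ∫ x, f x ∂m - ∫ x, g x ∂m - (∫ x, k x ∂m - ∫ x, l x ∂m) := by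
  have h1 : Integrable (fun x => f x - g x) m := hf.sub hg
  have h2 : Integrable (fun x => k x - l x) m := hk.sub hl
  rw [integral_sub h1 h2, integral_sub hf hg, integral_sub hk hl]

section SecondMoment

variable {μ : ℂ} {ν : Measure ℂ}

theorem IsEntryDistribution.memLp_two (h : IsEntryDistribution μ ν) :
    MemLp (fun x : ℂ => x) 2 ν := by
  have := h.isProbabilityMeasure
  exact h.memLp.mono_exponent (by norm_num)

theorem IsEntryDistribution.integrable_id (h : IsEntryDistribution μ ν) :
    Integrable (fun x : ℂ => x) ν := by
  have := h.isProbabilityMeasure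
  exact h.memLp.integrable (by norm_num)

theorem IsEntryDistribution.integrable_mul_conj (h : IsEntryDistribution μ ν) :
    Integrable (fun x : ℂ => x * conj x) ν := by
  have h1 := (memLp_two_iff_integrable_sq_norm h.memLp_two.1).1 h.memLp_two
  refine h1.ofReal.congr (ae_of_all _ fun x => ?_)
  simp [Complex.mul_conj, Complex.normSq_eq_norm_sq]

theorem IsEntryDistribution.integral_mul_conj (h : IsEntryDistribution μ ν) :
    ∫ x, x * conj x ∂ν = 1 + μ * conj μ := by
  have := h.isProbabilityMeasure
  have hi := h.integrable_id
  have hc : Integrable (fun x : ℂ => conj x) ν := Complex.conjCLE.toContinuousLinearMap.integrable_comp hi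
  have hm := h.integrable_mul_conj
  have h1 : ∫ x, (x - μ) * conj (x - μ) ∂ν = 1 := by
    have := congrArg (fun r : ℝ => (r : ℂ)) h.variance
    simp only [Complex.ofReal_one] at this
    rw [← this, ← integral_complex_ofReal]
    refine integral_congr_ae (ae_of_all _ fun x => ?_)
    simp only [Complex.mul_conj, Complex.normSq_eq_norm_sq]
  have hcv : ∫ x, conj x ∂ν = conj μ := by rw [integral_conj, h.mean]
  have h2 : ∀ x : ℂ, (x - μ) * conj (x - μ) =
      x * conj x - x * conj μ - (μ * conj x - μ * conj μ) := by
    intro x; rw [map_sub]; ring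
  simp_rw [h2] at h1
  rw [integral_sub_sub_sub hm (hi.mul_const _) (hc.const_mul _) (integrable_const _),
    integral_mul_const, integral_const_mul, h.mean, hcv] at h1
  simp only [integral_const, probReal_univ, one_smul] at h1
  linear_combination h1

variable {ι E : Type*} [Fintype E] [DecidableEq E]

/-- The product of the normalised entries with index in `S`. -/
noncomputable def normProd (μ : ℂ) (S : Finset E) (R : E → ℂ) : ℂ := ∏ e ∈ S, R e / μ

theorem normProd_mul_conj_eq (S T : Finset E) (R : E → ℂ) :
    normProd μ S R * conj (normProd μ T R) =
      ∏ e, (if e ∈ S then R e / μ else 1) * conj (if e ∈ T then R e / μ else 1) := by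
  rw [Finset.prod_mul_distrib, ← map_prod, Finset.prod_ite_mem, Finset.prod_ite_mem,
    Finset.univ_inter, Finset.univ_inter, normProd, normProd]

/-- These are the one-entry moments behind the product formula: `x / μ` and its conjugate have mean
1, and `‖x / μ‖ ^ 2` has mean `1 + ‖μ‖⁻²` because the variance is 1. -/
theorem IsEntryDistribution.factor (h : IsEntryDistribution μ ν) (hμ : μ ≠ 0)
    (p q : Prop) [Decidable p] [Decidable q] :
    Integrable (fun x : ℂ => (if p then x / μ else 1) * conj (if q then x / μ else 1)) ν ∧
    ∫ x, (if p then x / μ else 1) * conj (if q then x / μ else 1) ∂ν =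
      if p ∧ q then ((1 + (‖μ‖ ^ 2)⁻¹ : ℝ) : ℂ) else 1 := by
  have := h.isProbabilityMeasure
  have hμ' : conj μ ≠ 0 := (map_ne_zero _).2 hμ
  have hi := h.integrable_id
  have hc : Integrable (fun x : ℂ => conj x) ν := Complex.conjCLE.toContinuousLinearMap.integrable_comp hi
  have hm := h.integrable_mul_conj
  have hcv : ∫ x, conj x ∂ν = conj μ := by rw [integral_conj, h.mean]
  by_cases hp : p <;> by_cases hq : q <;> simp only [hp, hq, if_true, if_false, and_true, and_false,
    map_one, mul_one, one_mul, map_div₀]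
  · have e : ∀ x : ℂ, x / μ * (conj x / conj μ) = (μ * conj μ)⁻¹ * (x * conj x) := by
      intro x; field_simp
    simp_rw [e]
    refine ⟨hm.const_mul _, ?_⟩
    rw [integral_const_mul, h.integral_mul_conj]
    have : (((‖μ‖ ^ 2 : ℝ)) : ℂ) = μ * conj μ := by
      rw [Complex.mul_conj, Complex.normSq_eq_norm_sq]
    rw [Complex.ofReal_add, Complex.ofReal_inv, this]
    field_simp
    push_cast; ring
  · exact ⟨hi.div_const _, by rw [integral_div, h.mean, div_self hμ]⟩
  · exact ⟨hc.div_const _, by rw [integral_div, hcv, div_self hμ']⟩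
  · exact ⟨integrable_const _, by simp⟩

/-- By independence the expectation factors over the entries, and only those lying in both sets
contribute a factor other than 1. -/
theorem IsEntryDistribution.normProd_mul_conj (h : IsEntryDistribution μ ν) (hμ : μ ≠ 0)
    (S T : Finset E) :
    Integrable (fun R : E → ℂ => normProd μ S R * conj (normProd μ T R)) (Measure.pi fun _ => ν) ∧
    ∫ R : E → ℂ, normProd μ S R * conj (normProd μ T R) ∂(Measure.pi fun _ => ν) =
      (((1 + (‖μ‖ ^ 2)⁻¹) ^ (S ∩ T).card : ℝ) : ℂ) := by
  have := h.isProbabilityMeasure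
  simp_rw [normProd_mul_conj_eq]
  constructor
  · exact Integrable.fintype_prod (μ := fun _ => ν)
      (f := fun e x => (if e ∈ S then x / μ else 1) * conj (if e ∈ T then x / μ else 1))
      fun e => (h.factor hμ (e ∈ S) (e ∈ T)).1
  · rw [integral_fintype_prod_eq_prod (μ := fun _ => ν)
      (fun e x => (if e ∈ S then x / μ else 1) * conj (if e ∈ T then x / μ else 1))]
    simp_rw [fun e => (h.factor hμ (e ∈ S) (e ∈ T)).2, ← Finset.mem_inter]
    rw [Finset.prod_ite_mem, Finset.univ_inter, Finset.prod_const, Complex.ofReal_pow]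

/-- The constant 1 is the product over the empty set, so expanding the centred product gives four
instances of the preceding moment formula. -/
theorem IsEntryDistribution.normProd_sub_one_mul_conj (h : IsEntryDistribution μ ν) (hμ : μ ≠ 0)
    (S T : Finset E) :
    Integrable (fun R : E → ℂ => (normProd μ S R - 1) * conj (normProd μ T R - 1))
      (Measure.pi fun _ => ν) ∧
    ∫ R : E → ℂ, (normProd μ S R - 1) * conj (normProd μ T R - 1) ∂(Measure.pi fun _ => ν) =
      (((1 + (‖μ‖ ^ 2)⁻¹) ^ (S ∩ T).card - 1 : ℝ) : ℂ) := by
  have := h.isProbabilityMeasure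
  have e : ∀ R : E → ℂ, (normProd μ S R - 1) * conj (normProd μ T R - 1) =
      normProd μ S R * conj (normProd μ T R) - normProd μ S R * conj (normProd μ ∅ R) -
      (normProd μ ∅ R * conj (normProd μ T R) - normProd μ ∅ R * conj (normProd μ ∅ R)) := by
    intro R
    have : normProd μ ∅ R = 1 := by simp [normProd]
    rw [this, map_sub, map_one]; ring
  simp_rw [e]
  have h1 := h.normProd_mul_conj hμ S T
  have h2 := h.normProd_mul_conj hμ S ∅
  have h3 := h.normProd_mul_conj hμ ∅ T
  have h4 := h.normProd_mul_conj (E := E) hμ ∅ ∅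
  refine ⟨(h1.1.sub h2.1).sub (h3.1.sub h4.1), ?_⟩
  rw [integral_sub_sub_sub h1.1 h2.1 h3.1 h4.1, h1.2, h2.2, h3.2, h4.2]
  simp

theorem IsEntryDistribution.sum_normProd (h : IsEntryDistribution μ ν) (hμ : μ ≠ 0)
    (G : Finset ι) (S : ι → Finset E) :
    Integrable (fun R : E → ℂ => ‖∑ σ ∈ G, normProd μ (S σ) R - G.card‖ ^ 2)
      (Measure.pi fun _ => ν) ∧
    ∫ R : E → ℂ, ‖∑ σ ∈ G, normProd μ (S σ) R - G.card‖ ^ 2 ∂(Measure.pi fun _ => ν) =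
      ∑ σ ∈ G, ∑ τ ∈ G, ((1 + (‖μ‖ ^ 2)⁻¹) ^ (S σ ∩ S τ).card - 1) := by
  have e : ∀ R : E → ℂ, ((‖∑ σ ∈ G, normProd μ (S σ) R - G.card‖ ^ 2 : ℝ) : ℂ) =
      ∑ σ ∈ G, ∑ τ ∈ G, (normProd μ (S σ) R - 1) * conj (normProd μ (S τ) R - 1) := by
    intro R
    rw [← Complex.normSq_eq_norm_sq, ← Complex.mul_conj, ← Finset.sum_mul_sum, ← map_sum]
    simp
  have hint := fun σ τ => h.normProd_sub_one_mul_conj hμ (S σ) (S τ)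
  have hI : Integrable (fun R : E → ℂ => ((‖∑ σ ∈ G, normProd μ (S σ) R - G.card‖ ^ 2 : ℝ) : ℂ))
      (Measure.pi fun _ => ν) := by
    simp_rw [e]
    exact integrable_finsetSum _ fun σ _ => integrable_finsetSum _ fun τ _ => (hint σ τ).1
  refine ⟨hI.re.congr (ae_of_all _ fun R => by
    simp only [RCLike.re_eq_complex_re, Complex.ofReal_re]), ?_⟩
  apply Complex.ofReal_injective
  rw [← integral_complex_ofReal]
  simp_rw [e]
  rw [integral_finsetSum _ fun σ _ => integrable_finsetSum _ fun τ _ => (hint σ τ).1]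
  simp_rw [fun σ => integral_finsetSum (μ := Measure.pi fun _ => ν) G fun τ _ => (hint σ τ).1,
    fun σ τ => (hint σ τ).2]
  push_cast
  rfl

/-- Chebyshev's inequality for a sum of products of normalised entries. -/
theorem IsEntryDistribution.sum_normProd_chebyshev (h : IsEntryDistribution μ ν) (hμ : μ ≠ 0)
    (G : Finset ι) (hG : G.Nonempty) (S : ι → Finset E) {V η : ℝ} (hη : 0 < η)
    (hV : ∑ σ ∈ G, ∑ τ ∈ G, ((1 + (‖μ‖ ^ 2)⁻¹) ^ (S σ ∩ S τ).card - 1) ≤ V * (G.card : ℝ) ^ 2) :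
    (Measure.pi fun _ => ν) {R : E → ℂ | η ≤ ‖(∑ σ ∈ G, normProd μ (S σ) R) / G.card - 1‖} ≤
      ENNReal.ofReal (V / η ^ 2) := by
  have := h.isProbabilityMeasure
  obtain ⟨h1, h2⟩ := h.sum_normProd hμ G S
  have hc : (0 : ℝ) < G.card := by exact_mod_cast hG.card_pos
  have hc' : (G.card : ℂ) ≠ 0 := by exact_mod_cast hG.card_pos.ne'
  have h3 := mul_meas_ge_le_integral_of_nonneg (ae_of_all _ fun R => by positivity) h1
    ((η * G.card) ^ 2)
  rw [h2] at h3
  have hset : {R : E → ℂ | η ≤ ‖(∑ σ ∈ G, normProd μ (S σ) R) / G.card - 1‖} =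
      {R : E → ℂ | (η * G.card) ^ 2 ≤ ‖∑ σ ∈ G, normProd μ (S σ) R - G.card‖ ^ 2} := by
    ext R
    simp only [Set.mem_ofPred_eq]
    rw [sq_le_sq₀ (by positivity) (by positivity), ← le_div_iff₀ hc]
    have : (∑ σ ∈ G, normProd μ (S σ) R) / G.card - 1 =
      (∑ σ ∈ G, normProd μ (S σ) R - G.card) / G.card := by field_simp
    rw [this, norm_div, Complex.norm_natCast]
  rw [hset, ← ofReal_measureReal (measure_ne_top _ _)]
  apply ENNReal.ofReal_le_ofReal
  rw [le_div_iff₀ (by positivity)]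
  have := h3.trans hV
  rw [mul_pow] at this
  have h5 : 0 < (G.card : ℝ) ^ 2 := by positivity
  refine le_of_mul_le_mul_right ?_ h5
  linarith

end SecondMoment

/-! ### The second moment of the permanent -/

section Permanent

open Finset

/-- The tuples `(σ₁, …, σ_d)` of permutations with `σ₁ = 1`. -/
def permTuples (d n : ℕ) : Finset (Fin d → Equiv.Perm (Fin n)) :=
  {σ | ∀ k, k.val = 0 → σ k = 1}

theorem per_eq_sum_permTuples {d n : ℕ} (A : Tensor d n) :
    per A = ∑ σ ∈ permTuples d n, ∏ i : Fin n, A (fun k => σ k i) := rfl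

/-- The positions used by a tuple of permutations. -/
def positions {d n : ℕ} (σ : Fin d → Equiv.Perm (Fin n)) : Finset (Fin d → Fin n) :=
  univ.image fun i k => σ k i

theorem injective_position {d n : ℕ} (hd : 0 < d) (σ : Fin d → Equiv.Perm (Fin n)) :
    Function.Injective fun (i : Fin n) (k : Fin d) => σ k i := fun _ _ hij =>
  (σ ⟨0, hd⟩).injective (congrFun hij ⟨0, hd⟩)

theorem normProd_positions {d n : ℕ} (hd : 0 < d) (μ : ℂ) (σ : Fin d → Equiv.Perm (Fin n))
    (A : Tensor d n) :
    normProd μ (positions σ) A = (∏ i : Fin n, A (fun k => σ k i)) / μ ^ n := by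
  rw [normProd, positions, prod_image (injective_position hd σ).injOn, prod_div_distrib]
  simp

/-- Since `σ₁ = τ₁ = 1`, the first index of a position is its row, so a common position can only
arise from the same row in both tuples. -/
theorem card_positions_inter {d n : ℕ} (hd : 0 < d) {σ τ : Fin d → Equiv.Perm (Fin n)}
    (hσ : σ ∈ permTuples d n) (hτ : τ ∈ permTuples d n) :
    (positions σ ∩ positions τ).card = (univ.filter fun i => ∀ k, τ k i = σ k i).card := by
  have : positions σ ∩ positions τ =
      (univ.filter fun i => ∀ k, τ k i = σ k i).image fun i k => σ k i := by
    ext e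
    simp only [positions, mem_inter, mem_image, mem_univ, true_and, mem_filter]
    constructor
    · rintro ⟨⟨i, rfl⟩, j, hj⟩
      have h0 := congrFun hj ⟨0, hd⟩
      simp only [permTuples, mem_filter, mem_univ, true_and] at hσ hτ
      rw [hσ ⟨0, hd⟩ rfl, hτ ⟨0, hd⟩ rfl] at h0
      obtain rfl : j = i := h0
      exact ⟨j, fun k => congrFun hj k, rfl⟩
    · rintro ⟨i, hi, rfl⟩
      exact ⟨⟨i, rfl⟩, i, funext hi⟩
  rw [this, card_image_of_injective _ (injective_position hd σ)]

/-! ### Counting permutations with prescribed values -/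

theorem card_perm_fixing {n : ℕ} (T : Finset (Fin n)) :
    (univ.filter fun π : Equiv.Perm (Fin n) => ∀ i ∈ T, π i = i).card = (n - T.card).factorial := by
  have h := Fintype.card_congr (Equiv.Perm.subtypeEquivSubtypePerm fun i : Fin n => i ∉ T)
  rw [Fintype.card_perm, Fintype.card_subtype_compl, Fintype.card_fin, Fintype.card_coe,
    Fintype.card_subtype] at h
  rw [h]
  congr 1
  ext π
  simp

theorem card_perm_agreeing {n : ℕ} (ρ : Equiv.Perm (Fin n)) (T : Finset (Fin n)) :
    (univ.filter fun π : Equiv.Perm (Fin n) => ∀ i ∈ T, π i = ρ i).card =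
      (n - T.card).factorial := by
  rw [← card_perm_fixing T]
  refine card_bij (fun π _ => ρ⁻¹ * π) ?_ (fun a _ b _ h => mul_left_cancel h) ?_
  · intro π hπ
    simp only [mem_filter, mem_univ, true_and] at hπ ⊢
    intro i hi
    simp [Equiv.Perm.mul_apply, hπ i hi]
  · intro π hπ
    simp only [mem_filter, mem_univ, true_and] at hπ
    refine ⟨ρ * π, ?_, by simp⟩
    simp only [mem_filter, mem_univ, true_and]
    intro i hi
    simp [Equiv.Perm.mul_apply, hπ i hi]

theorem card_permTuples_agreeing {d n : ℕ} (hd : 0 < d) {σ : Fin d → Equiv.Perm (Fin n)}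
    (hσ : σ ∈ permTuples d n) (T : Finset (Fin n)) :
    ((permTuples d n).filter fun τ => ∀ i ∈ T, ∀ k, τ k i = σ k i).card =
      (n - T.card).factorial ^ (d - 1) := by
  obtain ⟨m, rfl⟩ : ∃ m, d = m + 1 := ⟨d - 1, by omega⟩
  have hs0 : σ 0 = 1 := by
    simp only [permTuples, mem_filter, mem_univ, true_and] at hσ
    exact hσ 0 rfl
  have h : (permTuples (m + 1) n).filter (fun τ => ∀ i ∈ T, ∀ k, τ k i = σ k i) =
      Fintype.piFinset fun k : Fin (m + 1) =>
        if k = 0 then {1} else univ.filter fun π : Equiv.Perm (Fin n) => ∀ i ∈ T, π i = σ k i := by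
    ext τ
    simp only [permTuples, mem_filter, mem_univ, true_and, Fintype.mem_piFinset]
    constructor
    · rintro ⟨h1, h2⟩ k
      split_ifs with hk
      · simpa using h1 k (by simp [hk])
      · simpa using fun i hi => h2 i hi k
    · intro h
      have h0 : τ 0 = 1 := by simpa using h 0
      refine ⟨fun k hk => ?_, fun i hi k => ?_⟩
      · rw [show k = 0 from Fin.ext hk, h0]
      · by_cases hk : k = 0
        · rw [hk, h0, hs0]
        · have := h k
          rw [if_neg hk] at this
          exact (mem_filter.1 this).2 i hi
  rw [h, Fintype.card_piFinset, Fin.prod_univ_succ]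
  simp [Fin.succ_ne_zero, card_perm_agreeing]

theorem one_mem_permTuples (d n : ℕ) : 1 ∈ permTuples d n := by simp [permTuples]

theorem card_permTuples {d n : ℕ} (hd : 0 < d) :
    (permTuples d n).card = n.factorial ^ (d - 1) := by
  simpa using card_permTuples_agreeing hd (one_mem_permTuples d n) ∅

/-- Expand `(1 + w) ^ |F|` as the sum of `w ^ |T|` over `T ⊆ F`, where `F` is the set of rows of
agreement, and exchange the sums. For fixed `T` it remains to count the tuples agreeing with `σ` on
`T`. -/
theorem sum_one_add_pow_agreeing {d n : ℕ} (hd : 0 < d) {σ : Fin d → Equiv.Perm (Fin n)}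
    (hσ : σ ∈ permTuples d n) (w : ℝ) :
    ∑ τ ∈ permTuples d n, (1 + w) ^ (univ.filter fun i => ∀ k, τ k i = σ k i).card =
      ∑ k ∈ range (n + 1), (n.choose k : ℝ) * (w ^ k * ((n - k).factorial : ℝ) ^ (d - 1)) := by
  have h1 : ∀ F : Finset (Fin n), (1 + w) ^ F.card =
      ∑ T : Finset (Fin n), if T ⊆ F then w ^ T.card else 0 := by
    intro F
    rw [add_comm, ← sum_pow_mul_eq_add_pow, ← sum_filter]
    simp only [one_pow, mul_one]
    congr 1
    ext T
    simp
  simp_rw [h1]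
  rw [sum_comm]
  have h2 : ∀ T : Finset (Fin n), (∑ τ ∈ permTuples d n,
      if T ⊆ (univ.filter fun i => ∀ k, τ k i = σ k i) then w ^ T.card else 0) =
      w ^ T.card * ((n - T.card).factorial : ℝ) ^ (d - 1) := by
    intro T
    rw [← sum_filter, sum_const, nsmul_eq_mul, mul_comm]
    congr 1
    have := card_permTuples_agreeing hd hσ T
    rw [← Nat.cast_pow, ← this]
    congr 2
    ext τ
    simp [subset_iff]
  simp_rw [h2]
  rw [← powerset_univ, sum_powerset_apply_card fun k => w ^ k * ((n - k).factorial : ℝ) ^ (d - 1)]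
  simp

/-- This is where order at least 3 enters, through two of the `d - 1` factors `(n - k)!`. One of
them completes `n.choose k * k!` to `n!`; another gains the factor `1 / n`, as `(n - k)! * n ≤ n!`
for `k ≥ 1`. The others are bounded by `n!`. -/
theorem choose_mul_factorial_pow_le {d n k : ℕ} (hd : 3 ≤ d) (hk : 1 ≤ k) (hkn : k ≤ n) :
    (n.choose k : ℝ) * ((n - k).factorial : ℝ) ^ (d - 1) ≤
      (n.factorial : ℝ) ^ (d - 1) / (k.factorial * n) := by
  obtain ⟨m, rfl⟩ : ∃ m, d = m + 3 := ⟨d - 3, by omega⟩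
  have hn : (0 : ℝ) < n := by exact_mod_cast (by omega : 0 < n)
  have hk0 : (0 : ℝ) < k.factorial := by exact_mod_cast k.factorial_pos
  rw [le_div_iff₀ (by positivity), show m + 3 - 1 = m + 1 + 1 by omega]
  have h1 : (n.choose k : ℝ) * k.factorial * (n - k).factorial = n.factorial := by
    exact_mod_cast Nat.choose_mul_factorial_mul_factorial hkn
  have h2 : ((n - k).factorial : ℝ) * n ≤ n.factorial := by
    have : (n - k).factorial * n ≤ n.factorial := by
      obtain ⟨l, rfl⟩ : ∃ l, n = l + 1 := ⟨n - 1, by omega⟩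
      rw [Nat.factorial_succ, mul_comm]
      exact Nat.mul_le_mul_left _ (Nat.factorial_le (by omega))
    exact_mod_cast this
  have h3 : ((n - k).factorial : ℝ) ^ m ≤ (n.factorial : ℝ) ^ m := by
    gcongr
    omega
  calc (n.choose k : ℝ) * ((n - k).factorial : ℝ) ^ (m + 1 + 1) * (k.factorial * n)
      = ((n.choose k : ℝ) * k.factorial * (n - k).factorial) *
        ((n - k).factorial : ℝ) ^ m * ((n - k).factorial * n) := by ring
    _ ≤ n.factorial * (n.factorial : ℝ) ^ m * n.factorial := by rw [h1]; gcongr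
    _ = _ := by ring

/-- Subtracting 1 from every summand cancels the term `k = 0` of the expansion. The remaining terms
are dominated by those of the exponential series times `n! ^ (d - 1) / n`. -/
theorem sum_sum_permTuples_le {d n : ℕ} (hd : 3 ≤ d) (hn : 1 ≤ n) {w : ℝ} (hw : 0 ≤ w) :
    ∑ σ ∈ permTuples d n, ∑ τ ∈ permTuples d n,
        ((1 + w) ^ (positions σ ∩ positions τ).card - 1) ≤
      Real.exp w / n * ((permTuples d n).card : ℝ) ^ 2 := by
  have hn0 : (0 : ℝ) < n := by exact_mod_cast hn
  have hinner : ∀ σ ∈ permTuples d n, ∑ τ ∈ permTuples d n,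
      ((1 + w) ^ (positions σ ∩ positions τ).card - 1) ≤
        Real.exp w / n * ((permTuples d n).card : ℝ) := by
    intro σ hσ
    rw [sum_sub_distrib, sum_congr rfl fun τ hτ => by
      rw [card_positions_inter (by omega) hσ hτ], sum_one_add_pow_agreeing (by omega) hσ,
      sum_range_succ', sum_const, nsmul_eq_mul, mul_one, card_permTuples (by omega)]
    simp only [Nat.choose_zero_right, Nat.cast_one, pow_zero, one_mul, Nat.sub_zero, Nat.cast_pow,
      add_sub_cancel_right]
    calc ∑ k ∈ range n, (n.choose (k + 1) : ℝ) *
          (w ^ (k + 1) * ((n - (k + 1)).factorial : ℝ) ^ (d - 1))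
        ≤ ∑ k ∈ range n, w ^ (k + 1) / (k + 1).factorial *
            ((n.factorial : ℝ) ^ (d - 1) / n) := by
          refine sum_le_sum fun k hk => ?_
          have := choose_mul_factorial_pow_le hd (k := k + 1) (by omega)
            (by have := mem_range.1 hk; omega : k + 1 ≤ n)
          calc _ = w ^ (k + 1) * ((n.choose (k + 1) : ℝ) *
                ((n - (k + 1)).factorial : ℝ) ^ (d - 1)) := by ring
            _ ≤ w ^ (k + 1) * ((n.factorial : ℝ) ^ (d - 1) / ((k + 1).factorial * n)) := by gcongr
            _ = _ := by field_simp
      _ = (∑ k ∈ range n, w ^ (k + 1) / (k + 1).factorial) *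
            ((n.factorial : ℝ) ^ (d - 1) / n) := by rw [sum_mul]
      _ ≤ Real.exp w * ((n.factorial : ℝ) ^ (d - 1) / n) := by
          gcongr
          have := Real.sum_le_exp_of_nonneg hw (n + 1)
          rw [sum_range_succ'] at this
          simp only [pow_zero, Nat.factorial_zero, Nat.cast_one, div_one] at this
          linarith
      _ = _ := by ring
  calc _ ≤ ∑ σ ∈ permTuples d n, Real.exp w / n * ((permTuples d n).card : ℝ) :=
        sum_le_sum hinner
    _ = _ := by rw [sum_const, nsmul_eq_mul]; ring

variable {μ : ℂ} {ν : Measure ℂ}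

/-- The permanent is concentrated around `μ ^ n * n! ^ (d - 1)`. -/
theorem IsEntryDistribution.per_concentration (h : IsEntryDistribution μ ν) (hμ : μ ≠ 0)
    {d n : ℕ} (hd : 3 ≤ d) (hn : 1 ≤ n) {η : ℝ} (hη : 0 < η) :
    tensorDistribution ν d n
        {R | η ≤ ‖per R / (μ ^ n * (n.factorial : ℂ) ^ (d - 1)) - 1‖} ≤
      ENNReal.ofReal (Real.exp (‖μ‖ ^ 2)⁻¹ / n / η ^ 2) := by
  have := h.sum_normProd_chebyshev hμ (permTuples d n) ⟨1, one_mem_permTuples d n⟩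
    positions hη (sum_sum_permTuples_le hd hn (by positivity))
  rw [tensorDistribution]
  convert this using 5 with R
  rw [per_eq_sum_permTuples, card_permTuples (by omega), Nat.cast_pow, ← div_div, sum_div]
  simp_rw [normProd_positions (show 0 < d by omega)]

/-- The average of the first `N` entries is concentrated around `μ`. -/
theorem IsEntryDistribution.average_concentration (h : IsEntryDistribution μ ν) (hμ : μ ≠ 0)
    {d n N : ℕ} (hN : 1 ≤ N) (hNd : N ≤ n ^ d) {η : ℝ} (hη : 0 < η) :
    tensorDistribution ν d n
        {R | η ≤ ‖(∑ a ∈ range N, inputArray R a) / N / μ - 1‖} ≤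
      ENNReal.ofReal ((‖μ‖ ^ 2)⁻¹ / N / η ^ 2) := by
  let e : Fin N ↪ (Fin d → Fin n) :=
    (Fin.castLEEmb hNd).trans finFunctionFinEquiv.symm.toEmbedding
  have hN0 : (0 : ℝ) < N := by exact_mod_cast hN
  -- The average is the case of singleton sets: distinct singletons are disjoint, so only the
  -- diagonal contributes to the variance.
  have := h.sum_normProd_chebyshev hμ (univ : Finset (Fin N)) ⟨⟨0, hN⟩, mem_univ _⟩
    (fun a => {e a}) (V := (‖μ‖ ^ 2)⁻¹ / N) hη (by
      have : ∀ a b : Fin N, (1 + (‖μ‖ ^ 2)⁻¹) ^ (({e a} : Finset _) ∩ {e b}).card - 1 =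
          if a = b then (‖μ‖ ^ 2)⁻¹ else 0 := by
        intro a b
        by_cases hab : a = b
        · simp [hab]
        · rw [if_neg hab, singleton_inter_of_notMem (by simpa using hab)]
          simp
      simp_rw [this]
      simp only [sum_ite_eq, mem_univ, if_true, sum_const, card_univ, Fintype.card_fin,
        nsmul_eq_mul]
      apply le_of_eq
      field_simp)
  rw [tensorDistribution]
  convert this using 5 with R
  rw [card_univ, Fintype.card_fin, div_right_comm, sum_div, ← Fin.sum_univ_eq_sum_range
    (fun a => inputArray R a / μ)]
  have : ∀ a : Fin N, inputArray R a / μ = normProd μ {e a} R := fun a => by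
    rw [normProd, prod_singleton, inputArray, dif_pos (lt_of_lt_of_le a.2 hNd)]
    rfl
  simp_rw [this]

end Permanent

/-! ### The approximation and its failure probability -/

/-- The value computed by the algorithm: for `1 ≤ ε ^ 4 * n` the estimate `m ^ n * n! ^ (d - 1)`, where
`m` is the average of the first `n ^ 3` entries; otherwise the exact permanent. -/
noncomputable def approxPer (d n : ℕ) (R : Tensor d n) (ε : ℝ) : ℂ :=
  if 1 ≤ ε ^ 4 * n then
    ((∑ a ∈ Finset.range (n ^ 3), inputArray R a) / (n ^ 3 : ℕ)) ^ n *
      (n.factorial : ℂ) ^ (d - 1)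
  else per R

/-- Chain of estimates: `‖z ^ n - 1‖ ≤ (1 + t) ^ n - 1 ≤ exp (n * t) - 1 ≤ 2 * (n * t)`, the last
one because `n * t ≤ 1`. -/
theorem norm_pow_sub_one_le {n : ℕ} {t : ℝ} {z : ℂ} (hz : ‖z - 1‖ ≤ t) (ht : n * t ≤ 1) :
    ‖z ^ n - 1‖ ≤ 2 * (n * t) := by
  have ht0 : 0 ≤ t := (norm_nonneg _).trans hz
  have h1 : ∀ m : ℕ, ‖z ^ m - 1‖ ≤ (1 + t) ^ m - 1 := by
    intro m
    induction m with
    | zero => simp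
    | succ m ih =>
      have e : z ^ (m + 1) - 1 = (z ^ m - 1) * (z - 1) + (z ^ m - 1) + (z - 1) := by ring
      rw [e]
      have h2 : ‖(z ^ m - 1) * (z - 1)‖ ≤ ((1 + t) ^ m - 1) * t := by
        rw [norm_mul]
        exact mul_le_mul ih hz (norm_nonneg _) ((norm_nonneg _).trans ih)
      calc _ ≤ ‖(z ^ m - 1) * (z - 1)‖ + ‖z ^ m - 1‖ + ‖z - 1‖ := norm_add₃_le
        _ ≤ ((1 + t) ^ m - 1) * t + ((1 + t) ^ m - 1) + t := by gcongr
        _ = _ := by ring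
  have h3 : (1 + t) ^ n ≤ Real.exp (n * t) := by
    rw [Real.exp_nat_mul]
    gcongr
    rw [add_comm]
    exact Real.add_one_le_exp t
  have h4 := Real.abs_exp_sub_one_le (x := n * t) (by rwa [abs_of_nonneg (by positivity)])
  rw [abs_of_nonneg (show (0:ℝ) ≤ n * t by positivity)] at h4
  linarith [h1 n, le_abs_self (Real.exp (n * t) - 1)]

theorem norm_one_sub_div_le {X Y : ℂ} {ε : ℝ} (h1 : ε ≤ 1)
    (hX : ‖X - 1‖ < ε / 4) (hY : ‖Y - 1‖ ≤ ε / 4) : X ≠ 0 ∧ ‖1 - Y / X‖ ≤ ε := by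
  have hX0 : 3 / 4 ≤ ‖X‖ := by
    have := norm_sub_norm_le (1 : ℂ) (1 - X)
    rw [norm_one, sub_sub_cancel, norm_sub_rev] at this
    linarith
  have hne : X ≠ 0 := norm_pos_iff.1 (by linarith)
  refine ⟨hne, ?_⟩
  have e : 1 - Y / X = ((X - 1) - (Y - 1)) / X := by field_simp; ring
  rw [e, norm_div, div_le_iff₀ (by linarith)]
  have := norm_sub_le (X - 1) (Y - 1)
  have := norm_nonneg (X - 1)
  nlinarith

/-- The failure event of the algorithm is contained in the union of two deviation events. -/
theorem failure_subset {d n : ℕ} (hn : 1 ≤ n) {μ : ℂ} (hμ : μ ≠ 0) {ε η : ℝ} (hε0 : 0 < ε)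
    (hε : ε < 1) (hη1 : η ≤ 1) (hηn : 1 ≤ ε ^ 4 * n → η = ε) :
    {R : Tensor d n | ¬ (per R ≠ 0 ∧ ‖1 - approxPer d n R ε / per R‖ ≤ ε)} ⊆
      {R | η / 4 ≤ ‖per R / (μ ^ n * (n.factorial : ℂ) ^ (d - 1)) - 1‖} ∪
      {R | η / (8 * n) ≤ ‖(∑ a ∈ Finset.range (n ^ 3), inputArray R a) / (n ^ 3 : ℕ) / μ - 1‖} := by
  intro R hR
  by_contra hcon
  simp only [Set.mem_union, Set.mem_ofPred_eq, not_or, not_le] at hcon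
  obtain ⟨h1, h2⟩ := hcon
  apply hR
  have hn0 : (0 : ℝ) < n := by exact_mod_cast hn
  have hD : μ ^ n * (n.factorial : ℂ) ^ (d - 1) ≠ 0 :=
    mul_ne_zero (pow_ne_zero _ hμ) (pow_ne_zero _ (by exact_mod_cast n.factorial_ne_zero))
  by_cases hb : 1 ≤ ε ^ 4 * n
  · rw [hηn hb] at h1 h2
    -- With relative error `ε / (8 * n)` in the mean, the `n`-th power has relative error at most `ε
    -- / 4`.
    have h3 := norm_pow_sub_one_le h2.le (by field_simp; linarith)
    have h4 := norm_one_sub_div_le hε.le h1 (h3.trans (le_of_eq (by field_simp; norm_num)))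
    refine ⟨fun h => h4.1 (by rw [h, zero_div]), ?_⟩
    convert h4.2 using 3
    rw [approxPer, if_pos hb, div_pow _ μ, div_div_div_eq]
    have := (div_ne_zero_iff.1 h4.1).1
    have : (n.factorial : ℂ) ^ (d - 1) ≠ 0 := right_ne_zero_of_mul hD
    field_simp
  -- The exhaustive branch is exact, so only the vanishing of the permanent could be a failure; that
  -- would be a deviation of 1, excluded by `η / 4 < 1`.
  · have : per R ≠ 0 := by
      intro h
      rw [h, zero_div, zero_sub, norm_neg, norm_one] at h1
      linarith
    rw [approxPer, if_neg hb, div_self this]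
    exact ⟨this, by simpa using hε0.le⟩

theorem IsEntryDistribution.failure_le {μ : ℂ} {ν : Measure ℂ} (h : IsEntryDistribution μ ν)
    (hμ : μ ≠ 0) {d n : ℕ} (hd : 3 ≤ d) (hn : 1 ≤ n)
    (hw : (‖μ‖ ^ 2)⁻¹ ≤ Real.log n / 4) {ε : ℝ} (hε0 : 0 < ε) (hε : ε < 1) :
    tensorDistribution ν d n {R | ¬ (per R ≠ 0 ∧ ‖1 - approxPer d n R ε / per R‖ ≤ ε)} ≤
      ENNReal.ofReal (80 * (n : ℝ) ^ (-(1 / 4) : ℝ)) := by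
  have hn0 : (0 : ℝ) < n := by exact_mod_cast hn
  have hn1 : (1 : ℝ) ≤ n := by exact_mod_cast hn
  -- The tolerance is `ε` in the estimating branch and 1 in the exhaustive one. Either way `η ^ 4 *
  -- n ≥ 1`, which makes the final bound independent of `ε`.
  obtain ⟨η, hη0, hη1, hηn, hη4⟩ : ∃ η : ℝ, 0 < η ∧ η ≤ 1 ∧ (1 ≤ ε ^ 4 * n → η = ε) ∧
      1 ≤ η ^ 4 * n := by
    by_cases hb : 1 ≤ ε ^ 4 * n
    · exact ⟨ε, hε0, hε.le, fun _ => rfl, hb⟩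
    · exact ⟨1, one_pos, le_rfl, fun h => absurd h hb, by simpa using hn1⟩
  refine (measure_mono (failure_subset hn hμ hε0 hε hη1 hηn)).trans
    ((measure_union_le _ _).trans ?_)
  have hN : 1 ≤ n ^ 3 := Nat.one_le_pow _ _ hn
  have hp1 := h.per_concentration hμ hd hn (show 0 < η / 4 by positivity)
  have hp2 := h.average_concentration hμ hN (Nat.pow_le_pow_right hn hd)
    (show 0 < η / (8 * n) by positivity)
  refine (add_le_add hp1 hp2).trans ?_
  set w := (‖μ‖ ^ 2)⁻¹ with hwdef
  have hw0 : 0 ≤ w := by positivity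
  rw [← ENNReal.ofReal_add (by positivity) (by positivity)]
  apply ENNReal.ofReal_le_ofReal
  have hsq : (n : ℝ) ^ (1 / 2 : ℝ) ≤ n * η ^ 2 := by
    rw [← Real.sqrt_eq_rpow, Real.sqrt_le_left (by positivity)]
    nlinarith
  have hexp : Real.exp w ≤ (n : ℝ) ^ (1 / 4 : ℝ) := by
    rw [Real.rpow_def_of_pos hn0]
    exact Real.exp_le_exp.2 (by linarith)
  have hw1 : w ≤ Real.exp w := by linarith [Real.add_one_le_exp w]
  calc Real.exp w / n / (η / 4) ^ 2 + w / (n ^ 3 : ℕ) / (η / (8 * n)) ^ 2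
      = (16 * Real.exp w + 64 * w) / (n * η ^ 2) := by push_cast; field_simp; ring
    _ ≤ (80 * (n : ℝ) ^ (1 / 4 : ℝ)) / (n : ℝ) ^ (1 / 2 : ℝ) := by gcongr; linarith
    _ = 80 * (n : ℝ) ^ (-(1 / 4) : ℝ) := by
      rw [mul_div_assoc, ← Real.rpow_sub hn0]; norm_num

/-- As `(d - 1) ^ 6 ≥ 1`, `c < 1 / 8` and `L ≥ 1`, the hypothesis gives `‖μ‖⁻¹ ≤ L ^ (1 / 8)`, so `t
= ‖μ‖⁻²` satisfies `t ^ 4 ≤ L`. If `t > L / 4`, then `L ^ 3 < 4 ^ 4 = 256`, contradicting `7 ^ 3 =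
343`; this explains the threshold 7. -/
theorem inv_norm_sq_le {c L : ℝ} (hc0 : 0 < c) (hc : c < 1 / 8) (hL : 7 ≤ L) {d : ℕ} (hd : 3 ≤ d)
    {μ : ℂ} (hμ : (L / ((d : ℝ) - 1) ^ 6) ^ (-c) ≤ ‖μ‖) : μ ≠ 0 ∧ (‖μ‖ ^ 2)⁻¹ ≤ L / 4 := by
  have hd1 : (1 : ℝ) ≤ (d : ℝ) - 1 := by
    have : (3 : ℝ) ≤ d := by exact_mod_cast hd
    linarith
  have hL0 : 0 < L := by linarith
  have hq : 0 < L / ((d : ℝ) - 1) ^ 6 := by positivity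
  have hqL : L / ((d : ℝ) - 1) ^ 6 ≤ L := div_le_self hL0.le (one_le_pow₀ hd1)
  have h0 : 0 < (L / ((d : ℝ) - 1) ^ 6) ^ (-c) := Real.rpow_pos_of_pos hq _
  have hμ0 : 0 < ‖μ‖ := h0.trans_le hμ
  refine ⟨norm_pos_iff.1 hμ0, ?_⟩
  have h1 : ‖μ‖⁻¹ ≤ L ^ (1 / 8 : ℝ) := by
    calc ‖μ‖⁻¹ ≤ ((L / ((d : ℝ) - 1) ^ 6) ^ (-c))⁻¹ := inv_anti₀ h0 hμ
      _ = (L / ((d : ℝ) - 1) ^ 6) ^ c := by rw [Real.rpow_neg hq.le, inv_inv]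
      _ ≤ L ^ c := Real.rpow_le_rpow hq.le hqL hc0.le
      _ ≤ L ^ (1 / 8 : ℝ) := Real.rpow_le_rpow_of_exponent_le (by linarith) hc.le
  have h8 : (‖μ‖⁻¹) ^ 8 ≤ L := by
    calc (‖μ‖⁻¹) ^ 8 ≤ (L ^ (1 / 8 : ℝ)) ^ 8 := by gcongr
      _ = L := by rw [← Real.rpow_natCast, ← Real.rpow_mul hL0.le]; norm_num
  rw [← inv_pow]
  set t := ‖μ‖⁻¹ ^ 2
  have ht : 0 ≤ t := by positivity
  have h4 : t ^ 4 ≤ L := by rw [← pow_mul]; exact h8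
  by_contra hcon
  push Not at hcon
  have : (L / 4) ^ 4 < t ^ 4 := by gcongr
  have h5 : (7 : ℝ) ^ 3 ≤ L ^ 3 := by gcongr
  nlinarith

/-- The bound for the failure probability. -/
noncomputable def failureBound (n : ℕ) : ℝ :=
  if Real.exp 7 ≤ n then 80 * (n : ℝ) ^ (-(1 / 4) : ℝ) else 1

theorem tendsto_failureBound : Tendsto failureBound atTop (𝓝 0) := by
  have h : Tendsto (fun n : ℕ => 80 * (n : ℝ) ^ (-(1 / 4) : ℝ)) atTop (𝓝 (80 * 0)) :=
    ((tendsto_rpow_neg_atTop (by norm_num)).comp tendsto_natCast_atTop_atTop).const_mul _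
  rw [mul_zero] at h
  refine h.congr' ?_
  filter_upwards [tendsto_natCast_atTop_atTop.eventually_ge_atTop (Real.exp 7)] with n hn
  rw [failureBound, if_pos hn]

/-- Below `exp 7` the trivial bound 1 is used. This also covers `n = 1`, where `log n = 0` and `0 ^
(-c) = 0` leave `μ` unrestricted. -/
theorem IsEntryDistribution.failure_le_failureBound {μ : ℂ} {ν : Measure ℂ}
    (h : IsEntryDistribution μ ν) {c : ℝ} (hc0 : 0 < c) (hc : c < 1 / 8) {d n : ℕ} (hd : 3 ≤ d)
    (hμ : (Real.log n / ((d : ℝ) - 1) ^ 6) ^ (-c) ≤ ‖μ‖) {ε : ℝ} (hε0 : 0 < ε) (hε : ε < 1) :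
    tensorDistribution ν d n {R | ¬ (per R ≠ 0 ∧ ‖1 - approxPer d n R ε / per R‖ ≤ ε)} ≤
      ENNReal.ofReal (failureBound n) := by
  rw [failureBound]
  split_ifs with hn
  · have hn0 : (0 : ℝ) < n := (Real.exp_pos 7).trans_le hn
    have hL : 7 ≤ Real.log n := (Real.le_log_iff_exp_le hn0).2 hn
    obtain ⟨h1, h2⟩ := inv_norm_sq_le hc0 hc hL hd hμ
    exact h.failure_le h1 hd (by exact_mod_cast hn0) h2 hε0 hε
  · have := h.isProbabilityMeasure
    rw [ENNReal.ofReal_one, tensorDistribution]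
    exact prob_le_one

/-! ### A program logic with running times -/

section Machine

variable {x : ℕ → ℂ}

/-- Started in `s`, the program `p` halts after at most `c` steps in a store satisfying `Q`. -/
def Halts (x : ℕ → ℂ) (p : Prog) (s : Store) (c : ℕ) (Q : Store → Prop) : Prop :=
  ∃ T u, Prog.Runs x p s T u ∧ T ≤ c ∧ Q u

theorem Halts.mono {p : Prog} {s : Store} {c c' : ℕ} {Q Q' : Store → Prop}
    (h : Halts x p s c Q) (hc : c ≤ c') (hQ : ∀ u, Q u → Q' u) : Halts x p s c' Q' := by
  obtain ⟨T, u, h1, h2, h3⟩ := h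
  exact ⟨T, u, h1, h2.trans hc, hQ u h3⟩

theorem Halts.seq {p q : Prog} {s : Store} {c c' : ℕ} {Q Q' : Store → Prop}
    (h : Halts x p s c Q) (h' : ∀ u, Q u → Halts x q u c' Q') :
    Halts x (.seq p q) s (c + c') Q' := by
  obtain ⟨T, u, h1, h2, h3⟩ := h
  obtain ⟨T', v, h4, h5, h6⟩ := h' u h3
  exact ⟨T + T', v, .seq h1 h4, Nat.add_le_add h2 h5, h6⟩

theorem Halts.instr {i : Instr} {s : Store} {Q : Store → Prop} (h : Q (i.exec x s)) :
    Halts x (.instr i) s 1 Q := ⟨1, _, .instr i s, le_rfl, h⟩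

theorem Halts.instr_seq {i : Instr} {q : Prog} {s : Store} {c : ℕ} {Q : Store → Prop}
    (h : Halts x q (i.exec x s) c Q) : Halts x (.seq (.instr i) q) s (1 + c) Q :=
  (Halts.instr (Q := fun u => u = i.exec x s) rfl).seq fun _ hu => hu ▸ h

theorem Halts.cond {b : Test} {p q : Prog} {s : Store} {c : ℕ} {Q : Store → Prop}
    (h1 : b.Holds s → Halts x p s c Q) (h2 : ¬ b.Holds s → Halts x q s c Q) :
    Halts x (.cond b p q) s (1 + c) Q := by
  by_cases hb : b.Holds s
  · obtain ⟨T, u, h3, h4, h5⟩ := h1 hb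
    exact ⟨1 + T, u, .condTrue hb h3, by omega, h5⟩
  · obtain ⟨T, u, h3, h4, h5⟩ := h2 hb
    exact ⟨1 + T, u, .condFalse hb h3, by omega, h5⟩

/-- The stores `s` and `u` agree on the integer registers below `a` and the numerical registers
below `b`. -/
def Agree (a b : ℕ) (s u : Store) : Prop :=
  (∀ j < a, u.int j = s.int j) ∧ ∀ j < b, u.num j = s.num j

theorem Agree.refl (a b : ℕ) (s : Store) : Agree a b s s := ⟨fun _ _ => rfl, fun _ _ => rfl⟩

theorem Agree.trans {a b : ℕ} {s u v : Store} (h : Agree a b s u) (h' : Agree a b u v) :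
    Agree a b s v :=
  ⟨fun j hj => (h'.1 j hj).trans (h.1 j hj), fun j hj => (h'.2 j hj).trans (h.2 j hj)⟩

theorem Agree.mono {a b a' b' : ℕ} {s u : Store} (h : Agree a b s u) (ha : a' ≤ a) (hb : b' ≤ b) :
    Agree a' b' s u :=
  ⟨fun j hj => h.1 j (hj.trans_le ha), fun j hj => h.2 j (hj.trans_le hb)⟩

theorem Agree.setInt {a b : ℕ} {s u : Store} (h : Agree a b s u) {r : ℕ} (hr : a ≤ r) (v : ℕ) :
    Agree a b s (u.setInt r v) :=
  ⟨fun j hj => by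
    simp only [Store.setInt, Function.update_of_ne (hj.trans_le hr).ne]; exact h.1 j hj, h.2⟩

theorem Agree.setNum {a b : ℕ} {s u : Store} (h : Agree a b s u) {r : ℕ} (hr : b ≤ r) (v : ℂ) :
    Agree a b s (u.setNum r v) :=
  ⟨h.1, fun j hj => by
    simp only [Store.setNum, Function.update_of_ne (hj.trans_le hr).ne]; exact h.2 j hj⟩

theorem Store.setInt_int (s : Store) (r v j : ℕ) :
    (s.setInt r v).int j = if j = r then v else s.int j := by
  simp [Store.setInt, Function.update_apply]

theorem Store.setNum_num (s : Store) (r : ℕ) (v : ℂ) (j : ℕ) :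
    (s.setNum r v).num j = if j = r then v else s.num j := by
  simp [Store.setNum, Function.update_apply]

theorem Store.setNum_int (s : Store) (r : ℕ) (v : ℂ) : (s.setNum r v).int = s.int := rfl

/-- Within `c` steps `p` writes `v` to the integer register `a`, preserving the integer registers
below `a` and the numerical registers below `b`. -/
def EvalsInt (x : ℕ → ℂ) (p : Prog) (a b : ℕ) (s : Store) (v c : ℕ) : Prop :=
  Halts x p s c fun u => u.int a = v ∧ Agree a b s u

/-- Within `c` steps `p` writes `v` to the numerical register `b`, preserving the integer registers
below `a` and the numerical registers below `b`. -/
def EvalsNum (x : ℕ → ℂ) (p : Prog) (a b : ℕ) (s : Store) (v : ℂ) (c : ℕ) : Prop :=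
  Halts x p s c fun u => u.num b = v ∧ Agree a b s u

theorem EvalsInt.le {p : Prog} {a b : ℕ} {s : Store} {v c c' : ℕ} (h : EvalsInt x p a b s v c)
    (hc : c ≤ c') : EvalsInt x p a b s v c' := h.mono hc fun _ => id

theorem EvalsNum.le {p : Prog} {a b : ℕ} {s : Store} {v : ℂ} {c c' : ℕ}
    (h : EvalsNum x p a b s v c) (hc : c ≤ c') : EvalsNum x p a b s v c' := h.mono hc fun _ => id

/-- `for a in [0, r)`: the integer register `a` is the counter. -/
def forProg (a r : ℕ) (body : Prog) : Prog :=
  .seq (.instr (.intConst a 0)) (.seq (.instr (.intConst (a + 1) 1))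
    (.loop (.intLe (a + 1) r) (.seq body (.seq (.instr (.intConst (a + 2) 1))
      (.seq (.instr (.intAdd a a (a + 2))) (.instr (.intAdd (a + 1) a (a + 2))))))))

/-- Register `a + 1` holds the counter plus one, so that the available test `≤` expresses a strict
inequality. It and the constant in `a + 2` are rebuilt at the end of each round, so the body may
overwrite both and need only preserve the counter. The registers from `f` up to `a` are left free
for an accumulator governed by the invariant `I`. -/
theorem halts_forProg {f a b r : ℕ} (hr : r < f) (hf : f ≤ a) {body : Prog} {s : Store} {c : ℕ}
    (I : ℕ → Store → Prop)
    (hI : ∀ i u v, u.num = v.num → (∀ j < a, v.int j = u.int j) → I i u → I i v)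
    (hbody : ∀ i < s.int r, ∀ u, Agree f b s u → I i u → u.int a = i →
      Halts x body u c fun v => I (i + 1) v ∧ v.int a = i ∧ Agree f b s v)
    (h0 : I 0 s) :
    Halts x (forProg a r body) s ((s.int r + 1) * (c + 4))
      fun u => I (s.int r) u ∧ Agree f b s u := by
  have key : ∀ m i, i + m = s.int r → ∀ u, Agree f b s u → I i u → u.int a = i →
      u.int (a + 1) = i + 1 →
      Halts x (.loop (.intLe (a + 1) r) (.seq body (.seq (.instr (.intConst (a + 2) 1))
      (.seq (.instr (.intAdd a a (a + 2))) (.instr (.intAdd (a + 1) a (a + 2))))))) u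
        (m * (c + 4) + 1) fun u => I (s.int r) u ∧ Agree f b s u := by
    intro m
    induction m with
    | zero =>
      intro i hi u hu hIu ha ha1
      refine ⟨1, u, .loopFalse ?_, by omega, ?_, hu⟩
      · simp only [Test.Holds, ha1, hu.1 r hr]; omega
      · rw [← hi]; exact hIu
    | succ m ih =>
      intro i hi u hu hIu ha ha1
      have h1 : Halts x (.seq body (.seq (.instr (.intConst (a + 2) 1))
          (.seq (.instr (.intAdd a a (a + 2))) (.instr (.intAdd (a + 1) a (a + 2)))))) u (c + 3)
          fun v => Agree f b s v ∧ I (i + 1) v ∧ v.int a = i + 1 ∧ v.int (a + 1) = i + 1 + 1 := by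
        refine (hbody i (by omega) u hu hIu ha).seq (c' := 3) fun v hv => ?_
        refine Halts.instr_seq (c := 2) (Halts.instr_seq (c := 1) (Halts.instr ?_))
        refine ⟨?_, ?_, ?_, ?_⟩
        · exact ((hv.2.2.setInt (by omega) _).setInt (by omega) _).setInt (by omega) _
        · refine hI _ v _ rfl (fun j hj => ?_) hv.1
          simp only [Instr.exec, Store.setInt_int]
          simp [show j ≠ a + 1 by omega, show j ≠ a by omega, show j ≠ a + 2 by omega]
        · simp [Instr.exec, Store.setInt_int, hv.2.1]
        · simp [Instr.exec, Store.setInt_int, hv.2.1]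
      obtain ⟨T, v, h2, h3, h4, h5, h6, h7⟩ := h1
      obtain ⟨T', w, h8, h9, h10⟩ := ih (i + 1) (by omega) v h4 h5 h6 h7
      refine ⟨1 + T + T', w, .loopTrue ?_ h2 h8, ?_, h10⟩
      · simp only [Test.Holds, ha1, hu.1 r hr]; omega
      · rw [Nat.succ_mul]; omega
  have h := key (s.int r) 0 (by omega) ((s.setInt a 0).setInt (a + 1) 1)
    (((Agree.refl f b s).setInt (by omega) _).setInt (by omega) _)
    (hI 0 s _ rfl (fun j hj => by
      simp [Store.setInt_int, show j ≠ a + 1 by omega, show j ≠ a by omega]) h0)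
    (by simp [Store.setInt_int]) (by simp [Store.setInt_int])
  refine (Halts.instr_seq (Halts.instr_seq h)).mono ?_ fun _ => id
  rw [Nat.succ_mul]; omega

/-- Iteration with an integer accumulator in register `a`. -/
def foldInt (a r : ℕ) (init step : Prog) : Prog :=
  .seq init (forProg (a + 1) r (.seq step (.seq (.instr (.intConst (a + 3) 0))
    (.instr (.intAdd a (a + 2) (a + 3))))))

/-- The step leaves its value in `a + 2`, from where it is copied to the accumulator by adding 0.
The counter sits in `a + 1`, so this overwrites only auxiliary registers that the loop restores. -/
theorem evalsInt_foldInt {a b r : ℕ} (hr : r < a) {init step : Prog} {s : Store} {c c' : ℕ}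
    (g : ℕ → ℕ) (h0 : EvalsInt x init a b s (g 0) c')
    (hstep : ∀ i < s.int r, ∀ u, Agree a b s u → u.int a = g i → u.int (a + 1) = i →
      EvalsInt x step (a + 2) b u (g (i + 1)) c) :
    EvalsInt x (foldInt a r init step) a b s (g (s.int r)) (c' + (s.int r + 1) * (c + 6)) := by
  refine h0.seq fun u hu => ?_
  have hur : u.int r = s.int r := hu.2.1 r hr
  have h := halts_forProg (x := x) (a := a + 1) (b := b) hr (by omega) (s := u) (c := c + 2)
    (body := .seq step (.seq (.instr (.intConst (a + 3) 0)) (.instr (.intAdd a (a + 2) (a + 3)))))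
    (fun i v => v.int a = g i) (fun i v w _ hi hv => (hi a (by omega)).trans hv)
    (fun i hi v hv hva hvi => by
      refine (hstep i (hur ▸ hi) v (hu.2.trans hv) hva hvi).seq fun w hw => ?_
      refine Halts.instr_seq (c := 1) (Halts.instr ⟨?_, ?_, ?_⟩)
      · simp [Instr.exec, Store.setInt_int, hw.1]
      · simpa [Instr.exec, Store.setInt_int, hvi] using hw.2.1 (a + 1) (by omega)
      · exact ((hv.trans (hw.2.mono (by omega) le_rfl)).setInt (by omega) _).setInt le_rfl _)
    hu.1
  rw [hur] at h
  exact h.mono le_rfl fun v hv => ⟨hv.1, hu.2.trans hv.2⟩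

/-! ### Integer arithmetic from addition and subtraction -/

theorem evalsInt_const (a b k : ℕ) (s : Store) :
    EvalsInt x (.instr (.intConst a k)) a b s k 1 :=
  Halts.instr ⟨by simp [Instr.exec, Store.setInt_int], (Agree.refl a b s).setInt le_rfl _⟩

theorem evalsInt_add (a b r t : ℕ) (s : Store) :
    EvalsInt x (.instr (.intAdd a r t)) a b s (s.int r + s.int t) 1 :=
  Halts.instr ⟨by simp [Instr.exec, Store.setInt_int], (Agree.refl a b s).setInt le_rfl _⟩

/-- `a := r`. -/
def copyInt (a r : ℕ) : Prog :=
  .seq (.instr (.intConst a 0)) (.instr (.intAdd a r a))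

theorem evalsInt_copyInt {a r : ℕ} (hr : r < a) (b : ℕ) (s : Store) :
    EvalsInt x (copyInt a r) a b s (s.int r) 2 :=
  Halts.instr_seq (c := 1) (Halts.instr ⟨by simp [Instr.exec, Store.setInt_int, hr.ne],
    ((Agree.refl a b s).setInt le_rfl _).setInt le_rfl _⟩)

/-- `a := r * t`. -/
def mulInt (a r t : ℕ) : Prog :=
  foldInt a r (.instr (.intConst a 0)) (.instr (.intAdd (a + 2) a t))

theorem evalsInt_mulInt {a r t : ℕ} (hr : r < a) (ht : t < a) (b : ℕ) (s : Store) :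
    EvalsInt x (mulInt a r t) a b s (s.int r * s.int t) (7 * s.int r + 8) := by
  refine (evalsInt_foldInt (x := x) (b := b) (s := s) (c := 1) (c' := 1) hr
    (fun i => i * s.int t) ?_ ?_).le (by omega)
  · simpa using evalsInt_const a b 0 s
  · intro i _ u hu hua _
    have := evalsInt_add (x := x) (a + 2) b a t u
    rwa [hua, hu.1 t ht, ← Nat.succ_mul] at this

/-- `a := r ^ t`. -/
def powInt (a r t : ℕ) : Prog :=
  foldInt a t (.instr (.intConst a 1)) (mulInt (a + 2) r a)

/-- The inner multiplication loops over the base and not over the accumulated power, so one round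
costs only a multiple of the base. -/
theorem evalsInt_powInt {a r t : ℕ} (hr : r < a) (ht : t < a) (b : ℕ) (s : Store) :
    EvalsInt x (powInt a r t) a b s (s.int r ^ s.int t)
      (1 + (s.int t + 1) * (7 * s.int r + 14)) := by
  refine evalsInt_foldInt (x := x) (b := b) (s := s) ht (fun i => s.int r ^ i) ?_ ?_
  · simpa using evalsInt_const a b 1 s
  · intro i _ u hu hua _
    have := evalsInt_mulInt (x := x) (a := a + 2) (r := r) (t := a) (by omega) (by omega) b u
    rwa [hua, hu.1 r hr, ← Nat.pow_succ'] at this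

/-- `a := r / t`. -/
def divInt (a r t : ℕ) : Prog :=
  .seq (.instr (.intConst a 0)) (.seq (copyInt (a + 1) r)
    (.loop (.intLe t (a + 1)) (.seq (.instr (.intSub (a + 1) (a + 1) t))
      (.seq (.instr (.intConst (a + 2) 1)) (.instr (.intAdd a a (a + 2)))))))

theorem evalsInt_divInt {a r t : ℕ} (hr : r < a) (ht : t < a) (b : ℕ) (s : Store)
    (hpos : 0 < s.int t) :
    EvalsInt x (divInt a r t) a b s (s.int r / s.int t) (4 * s.int r + 4) := by
  have key : ∀ m q u, Agree a b s u → u.int a = q → u.int (a + 1) = m →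
      Halts x (.loop (.intLe t (a + 1)) (.seq (.instr (.intSub (a + 1) (a + 1) t))
      (.seq (.instr (.intConst (a + 2) 1)) (.instr (.intAdd a a (a + 2)))))) u (4 * m + 1)
        fun v => v.int a = q + m / s.int t ∧ Agree a b s v := by
    intro m
    induction m using Nat.strong_induction_on with
    | _ m ih =>
      intro q u hu hq hm
      by_cases hle : s.int t ≤ m
      · have h1 : Halts x (.seq (.instr (.intSub (a + 1) (a + 1) t))
            (.seq (.instr (.intConst (a + 2) 1)) (.instr (.intAdd a a (a + 2))))) u 3
            fun v => Agree a b s v ∧ v.int a = q + 1 ∧ v.int (a + 1) = m - s.int t := by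
          refine Halts.instr_seq (c := 2) (Halts.instr_seq (c := 1) (Halts.instr ⟨?_, ?_, ?_⟩))
          · exact ((hu.setInt (by omega) _).setInt (by omega) _).setInt (by omega) _
          · simp [Instr.exec, Store.setInt_int, hq]
          · simp [Instr.exec, Store.setInt_int, hm, hu.1 t ht]
        obtain ⟨T, v, h2, h3, h4, h5, h6⟩ := h1
        obtain ⟨T', w, h7, h8, h9, h10⟩ := ih (m - s.int t) (by omega) (q + 1) v h4 h5 h6
        refine ⟨1 + T + T', w, .loopTrue ?_ h2 h7, by omega, ?_, h10⟩
        · simpa only [Test.Holds, hm, hu.1 t ht] using hle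
        · rw [h9, Nat.div_eq_sub_div hpos hle]; omega
      · refine ⟨1, u, .loopFalse ?_, by omega, ?_, hu⟩
        · simpa only [Test.Holds, hm, hu.1 t ht] using hle
        · rw [hq, Nat.div_eq_of_lt (by omega), add_zero]
  refine (Halts.instr_seq ((evalsInt_copyInt (x := x) (a := a + 1) (r := r) (by omega) b _).seq
    fun u hu => ?_)).mono (c := 1 + (2 + (4 * s.int r + 1))) (by omega) fun _ => id
  have hr' : (Instr.exec x s (.intConst a 0)).int r = s.int r := by
    simp [Instr.exec, Store.setInt_int, hr.ne]
  have := key (s.int r) 0 u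
    (((Agree.refl a b s).setInt le_rfl _).trans (hu.2.mono (by omega) le_rfl))
    ((hu.2.1 a (by omega)).trans (by simp [Instr.exec, Store.setInt_int])) (hu.1.trans hr')
  simpa using this

/-- `a := a % t`. -/
def modInt (a t : ℕ) : Prog := .loop (.intLe t a) (.instr (.intSub a a t))

theorem evalsInt_modInt {a t : ℕ} (ht : t < a) (b : ℕ) (s : Store) (hpos : 0 < s.int t) :
    EvalsInt x (modInt a t) a b s (s.int a % s.int t) (2 * s.int a + 1) := by
  have key : ∀ m u, Agree a b s u → u.int a = m →
      Halts x (modInt a t) u (2 * m + 1) fun v => v.int a = m % s.int t ∧ Agree a b s v := by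
    intro m
    induction m using Nat.strong_induction_on with
    | _ m ih =>
      intro u hu hm
      by_cases hle : s.int t ≤ m
      · obtain ⟨T, v, h1, h2, h3⟩ := ih (m - s.int t) (by omega) (Instr.exec x u (.intSub a a t))
          (hu.setInt le_rfl _) (by simp [Instr.exec, Store.setInt_int, hm, hu.1 t ht])
        refine ⟨1 + 1 + T, v, .loopTrue ?_ (.instr _ _) h1, by omega, ?_⟩
        · simpa only [Test.Holds, hm, hu.1 t ht] using hle
        · rwa [← Nat.mod_eq_sub_mod hle] at h3
      · refine ⟨1, u, .loopFalse ?_, by omega, ?_, hu⟩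
        · simpa only [Test.Holds, hm, hu.1 t ht] using hle
        · rw [hm, Nat.mod_eq_of_lt (by omega)]
  exact key _ s (Agree.refl a b s) rfl

/-- `a := r / t ^ m % t`, the digit number `m` of `r` in base `t`. -/
def digitInt (a r t m : ℕ) : Prog :=
  .seq (foldInt a m (copyInt a r) (divInt (a + 2) a t)) (modInt a t)

theorem evalsInt_digitInt {a r t m : ℕ} (hr : r < a) (ht : t < a) (hm : m < a) (b : ℕ) (s : Store)
    (hpos : 0 < s.int t) :
    EvalsInt x (digitInt a r t m) a b s (s.int r / s.int t ^ s.int m % s.int t)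
      (2 + (s.int m + 1) * (4 * s.int r + 10) + (2 * s.int r + 1)) := by
  have h := evalsInt_foldInt (x := x) (b := b) (s := s) (c := 4 * s.int r + 4) (c' := 2) hm
    (init := copyInt a r) (step := divInt (a + 2) a t)
    (fun i => s.int r / s.int t ^ i) (by simpa using evalsInt_copyInt hr b s) (by
      intro i _ u hu hua _
      have ht' : u.int t = s.int t := hu.1 t ht
      have := evalsInt_divInt (x := x) (a := a + 2) (r := a) (t := t) (by omega) (by omega) b u
        (by omega)
      rw [ht', hua, Nat.div_div_eq_div_mul, ← Nat.pow_succ] at this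
      have hle := Nat.div_le_self (s.int r) (s.int t ^ i)
      exact this.le (by omega))
  refine h.seq fun u hu => ?_
  have ht' : u.int t = s.int t := hu.2.1 t ht
  have h2 := evalsInt_modInt (x := x) ht b u (by omega)
  rw [hu.1, ht'] at h2
  have hle := Nat.div_le_self (s.int r) (s.int t ^ s.int m)
  exact h2.mono (by omega) fun v hv => ⟨hv.1, hu.2.trans hv.2⟩

/-! ### Numerical expressions, finite sums and products -/

theorem EvalsInt.letNum {p q : Prog} {a b : ℕ} {s : Store} {v c c' : ℕ} {w : ℂ}
    (h : EvalsInt x p a b s v c)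
    (h' : ∀ u, Agree a b s u → u.int a = v → EvalsNum x q (a + 1) b u w c') :
    EvalsNum x (.seq p q) a b s w (c + c') :=
  Halts.seq h fun u hu => (h' u hu.2 hu.1).mono le_rfl fun _ hv =>
    ⟨hv.1, hu.2.trans (hv.2.mono (by omega) le_rfl)⟩

/-- A binary operation on the values of two numerical programs. -/
theorem EvalsNum.binary {p q : Prog} {a b : ℕ} {s : Store} {v w : ℂ} {c c' : ℕ}
    (h : EvalsNum x p a b s v c)
    (h' : ∀ u, Agree a b s u → EvalsNum x q a (b + 1) u w c') {i : Instr} {op : ℂ → ℂ → ℂ}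
    (hi : ∀ u, i.exec x u = u.setNum b (op (u.num b) (u.num (b + 1)))) :
    EvalsNum x (.seq p (.seq q (.instr i))) a b s (op v w) (c + (c' + 1)) :=
  Halts.seq h fun u hu => (h' u hu.2).seq fun t ht => Halts.instr ⟨by
    rw [hi, Store.setNum_num, if_pos rfl, ht.1, ht.2.2 b (by omega), hu.1], by
    rw [hi]; exact (hu.2.trans (ht.2.mono le_rfl (by omega))).setNum le_rfl _⟩

/-- The product of two numerical values. -/
def mulNum (b : ℕ) (p q : Prog) : Prog := .seq p (.seq q (.instr (.numMul b b (b + 1))))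

/-- The quotient of two numerical values. -/
def divNum (b : ℕ) (p q : Prog) : Prog := .seq p (.seq q (.instr (.numDiv b b (b + 1))))

theorem EvalsNum.mulNum {p q : Prog} {a b : ℕ} {s : Store} {v w : ℂ} {c c' : ℕ}
    (h : EvalsNum x p a b s v c) (h' : ∀ u, Agree a b s u → EvalsNum x q a (b + 1) u w c') :
    EvalsNum x (mulNum b p q) a b s (v * w) (c + (c' + 1)) :=
  h.binary h' (op := (· * ·)) fun _ => rfl

theorem EvalsNum.divNum {p q : Prog} {a b : ℕ} {s : Store} {v w : ℂ} {c c' : ℕ}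
    (h : EvalsNum x p a b s v c) (h' : ∀ u, Agree a b s u → EvalsNum x q a (b + 1) u w c') :
    EvalsNum x (divNum b p q) a b s (v / w) (c + (c' + 1)) :=
  h.binary h' (op := (· / ·)) fun _ => rfl

theorem evalsNum_ofInt (a b r : ℕ) (s : Store) :
    EvalsNum x (.instr (.numOfInt b r)) a b s (s.int r) 1 :=
  Halts.instr ⟨by simp [Instr.exec, Store.setNum_num], (Agree.refl a b s).setNum le_rfl _⟩

theorem evalsNum_read (a b r : ℕ) (s : Store) :
    EvalsNum x (.instr (.numRead b r)) a b s (x (s.int r)) 1 :=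
  Halts.instr ⟨by simp [Instr.exec, Store.setNum_num], (Agree.refl a b s).setNum le_rfl _⟩

/-- A numerical constant; `a` is a scratch register. -/
def constNum (a b k : ℕ) : Prog := .seq (.instr (.intConst a k)) (.instr (.numOfInt b a))

theorem evalsNum_constNum (a b k : ℕ) (s : Store) :
    EvalsNum x (constNum a b k) a b s (k : ℂ) 2 :=
  show EvalsNum x _ a b s _ (1 + 1) from (evalsInt_const a b k s).letNum fun u _ hu => by simpa [hu] using evalsNum_ofInt (a + 1) b a u

/-- `p` if the integer registers `r` and `t` are equal, otherwise `q`. -/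
def eqCond (r t : ℕ) (p q : Prog) : Prog := .cond (.intLe r t) (.cond (.intLe t r) p q) q

theorem evalsNum_eqCond {r t : ℕ} {p q : Prog} {a b : ℕ} {s : Store} {v w : ℂ} {c : ℕ}
    (hp : EvalsNum x p a b s v c) (hq : EvalsNum x q a b s w c) :
    EvalsNum x (eqCond r t p q) a b s (if s.int r = s.int t then v else w) (c + 2) := by
  refine Halts.mono (c := 1 + (1 + c)) (Halts.cond (fun h1 => Halts.cond (fun h2 => ?_)
    fun h2 => ?_) fun h1 => ?_) (by omega) fun _ => id
  · simp only [Test.Holds] at h1 h2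
    rw [if_pos (le_antisymm h1 h2)]; exact hp
  · simp only [Test.Holds] at h1 h2
    rw [if_neg (by omega)]; exact hq
  · simp only [Test.Holds] at h1
    rw [if_neg (by omega)]; exact hq.mono (by omega) fun _ => id

/-- Iteration of a binary operation with a numerical accumulator in register `b`. -/
theorem evalsNum_for {a b r : ℕ} (hr : r < a) {init body : Prog} {i : Instr} {op : ℂ → ℂ → ℂ}
    (hi : ∀ u, i.exec x u = u.setNum b (op (u.num b) (u.num (b + 1)))) {s : Store} {c c' : ℕ}
    (g f : ℕ → ℂ) (h0 : EvalsNum x init a b s (g 0) c') (hg : ∀ i, g (i + 1) = op (g i) (f i))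
    (hbody : ∀ i < s.int r, ∀ u, Agree a b s u → u.int a = i →
      EvalsNum x body (a + 1) (b + 1) u (f i) c) :
    EvalsNum x (.seq init (forProg a r (.seq body (.instr i)))) a b s (g (s.int r))
      (c' + (s.int r + 1) * (c + 5)) := by
  refine Halts.seq h0 fun u hu => ?_
  have hur : u.int r = s.int r := hu.2.1 r hr
  have h := halts_forProg (x := x) (a := a) (b := b) hr le_rfl (s := u) (c := c + 1)
    (body := .seq body (.instr i))
    (fun i v => v.num b = g i) (fun i v w hn _ hv => hn ▸ hv)
    (fun j hj v hv hva hvj => by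
      refine (hbody j (hur ▸ hj) v (hu.2.trans hv) hvj).seq fun w hw => Halts.instr ?_
      rw [hi]
      refine ⟨?_, ?_, (hv.trans (hw.2.mono (by omega) (by omega))).setNum le_rfl _⟩
      · rw [Store.setNum_num, if_pos rfl, hw.1, hw.2.2 b (by omega), hva, hg]
      · rw [Store.setNum_int, hw.2.1 a (by omega), hvj])
    hu.1
  rw [hur] at h
  exact h.mono le_rfl fun v hv => ⟨hv.1, hu.2.trans hv.2⟩

/-- The sum of the values of `body` over the values of the counter `a` below `r`. -/
def sumNum (a b r : ℕ) (body : Prog) : Prog :=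
  .seq (constNum a b 0) (forProg a r (.seq body (.instr (.numAdd b b (b + 1)))))

/-- The product of the values of `body` over the values of the counter `a` below `r`. -/
def prodNum (a b r : ℕ) (body : Prog) : Prog :=
  .seq (constNum a b 1) (forProg a r (.seq body (.instr (.numMul b b (b + 1)))))

theorem evalsNum_sumNum {a b r : ℕ} (hr : r < a) {body : Prog} {s : Store} {c n M : ℕ} (hn : s.int r = n) (hM : n ≤ M)
    (f : ℕ → ℂ) (hbody : ∀ i < n, ∀ u, Agree a b s u → u.int a = i →
      EvalsNum x body (a + 1) (b + 1) u (f i) c) :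
    EvalsNum x (sumNum a b r body) a b s (∑ i ∈ Finset.range n, f i)
      (2 + (M + 1) * (c + 5)) := by
  subst hn
  exact (evalsNum_for hr (op := (· + ·)) (fun _ => rfl) (fun n => ∑ i ∈ Finset.range n, f i) f
    (by simpa using evalsNum_constNum a b 0 s) (fun i => Finset.sum_range_succ f i) hbody).le (by gcongr)

theorem evalsNum_prodNum {a b r : ℕ} (hr : r < a) {body : Prog} {s : Store} {c n M : ℕ} (hn : s.int r = n) (hM : n ≤ M)
    (f : ℕ → ℂ) (hbody : ∀ i < n, ∀ u, Agree a b s u → u.int a = i →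
      EvalsNum x body (a + 1) (b + 1) u (f i) c) :
    EvalsNum x (prodNum a b r body) a b s (∏ i ∈ Finset.range n, f i)
      (2 + (M + 1) * (c + 5)) := by
  subst hn
  exact (evalsNum_for hr (op := (· * ·)) (fun _ => rfl) (fun n => ∏ i ∈ Finset.range n, f i) f
    (by simpa using evalsNum_constNum a b 1 s) (fun i => Finset.prod_range_succ f i) hbody).le (by gcongr)

end Machine

/-! ### Exhaustive computation of the permanent -/

section Exhaustive

/-- The contribution of row `i` to the exhaustive sum: the entry with address `D N v i`, or `0` if its
first index is not `i` or if it shares an index with an earlier row; here `D b v m` is digit `m` of `v` in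
base `b`. -/
noncomputable def rowValue (x : ℕ → ℂ) (n d N v i : ℕ) : ℂ :=
  x (v / N ^ i % N) * ((if v / N ^ i % N / n ^ 0 % n = i then 1 else 0) *
    ∏ j ∈ Finset.range i, ∏ k ∈ Finset.range d,
      if v / N ^ i % N / n ^ k % n = v / N ^ j % N / n ^ k % n then 0 else 1)

/-- A tuple of permutations is read row by row as an assignment of index tuples. Conversely, rows
that pairwise differ in every index make each coordinate map injective, hence bijective on a finite
set. -/
theorem per_eq_sum_functions {d n : ℕ} (hd : 0 < d) (R : Tensor d n) :
    per R = ∑ F : Fin n → Fin d → Fin n,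
      if (∀ i, F i ⟨0, hd⟩ = i) ∧ ∀ i j, j < i → ∀ k, F i k ≠ F j k then ∏ i, R (F i) else 0 := by
  rw [per_eq_sum_permTuples, ← Finset.sum_filter]
  refine Finset.sum_bij (fun σ _ i k => σ k i) ?_ ?_ ?_ ?_
  · intro σ hσ
    simp only [permTuples, Finset.mem_filter, Finset.mem_univ, true_and] at hσ ⊢
    exact ⟨fun i => by rw [hσ ⟨0, hd⟩ rfl]; rfl, fun i j hij k h => hij.ne' ((σ k).injective h)⟩
  · intro σ _ τ _ h
    funext k
    ext i
    rw [congrFun (congrFun h i) k]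
  · intro F hF
    simp only [Finset.mem_filter, Finset.mem_univ, true_and] at hF
    have hinj : ∀ k, Function.Bijective fun i => F i k := fun k =>
      Finite.injective_iff_bijective.1 fun i j h => by
        rcases lt_trichotomy i j with hij | hij | hij
        · exact absurd h.symm (hF.2 j i hij k)
        · exact hij
        · exact absurd h (hF.2 i j hij k)
    refine ⟨fun k => Equiv.ofBijective _ (hinj k), ?_, rfl⟩
    simp only [permTuples, Finset.mem_filter, Finset.mem_univ, true_and]
    intro k hk
    obtain rfl : k = ⟨0, hd⟩ := Fin.ext hk
    ext i
    simp [hF.1 i]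
  · intro σ _
    rfl

/-- `finFunctionFinEquiv` is positional notation. Applied twice it encodes `F` as a number below `(n
^ d) ^ n` whose digits in base `n ^ d` are entry addresses, and the digits of these in base `n` are
the indices. -/
theorem rowValue_finFunction {d n : ℕ} (hd : 0 < d) (R : Tensor d n) (F : Fin n → Fin d → Fin n)
    (i : Fin n) :
    rowValue (inputArray R) n d (n ^ d)
        (finFunctionFinEquiv fun j => finFunctionFinEquiv (F j) : Fin ((n ^ d) ^ n)) i =
      if F i ⟨0, hd⟩ = i ∧ ∀ j < i, ∀ k, F i k ≠ F j k then R (F i) else 0 := by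
  have h1 : ∀ j : Fin n, ((finFunctionFinEquiv fun j => finFunctionFinEquiv (F j) :
      Fin ((n ^ d) ^ n)) : ℕ) / (n ^ d) ^ (j : ℕ) % (n ^ d) = (finFunctionFinEquiv (F j) : ℕ) := by
    intro j
    rw [← finFunctionFinEquiv_symm_apply_val, Equiv.symm_apply_apply]
  have h2 : ∀ (j : Fin n) (k : Fin d),
      (finFunctionFinEquiv (F j) : ℕ) / n ^ (k : ℕ) % n = F j k := by
    intro j k
    rw [← finFunctionFinEquiv_symm_apply_val, Equiv.symm_apply_apply]
  have h3 : (∏ j ∈ Finset.range i, ∏ k ∈ Finset.range d,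
      if ((finFunctionFinEquiv fun j => finFunctionFinEquiv (F j) :
        Fin ((n ^ d) ^ n)) : ℕ) / (n ^ d) ^ (i : ℕ) % (n ^ d) / n ^ k % n =
        ((finFunctionFinEquiv fun j => finFunctionFinEquiv (F j) :
        Fin ((n ^ d) ^ n)) : ℕ) / (n ^ d) ^ j % (n ^ d) / n ^ k % n then (0 : ℂ) else 1) =
      if ∀ j < i, ∀ k, F i k ≠ F j k then 1 else 0 := by
    simp_rw [← ite_not _ (1 : ℂ) 0, Finset.prod_ite_zero, Finset.prod_const_one]
    congr 1
    apply propext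
    constructor
    · intro h j hj k
      have := h j (Finset.mem_range.2 hj) k (Finset.mem_range.2 k.2)
      rw [h1 i, h1 j, h2, h2] at this
      exact fun e => this (congrArg Fin.val e)
    · intro h j hj k hk
      have hj := Finset.mem_range.1 hj
      have := h ⟨j, hj.trans i.2⟩ hj ⟨k, Finset.mem_range.1 hk⟩
      rw [h1 i, h1 ⟨j, hj.trans i.2⟩, h2 i ⟨k, Finset.mem_range.1 hk⟩,
        h2 ⟨j, hj.trans i.2⟩ ⟨k, Finset.mem_range.1 hk⟩]
      exact fun e => this (Fin.ext e)
  have h4 : inputArray R (finFunctionFinEquiv (F i) : ℕ) = R (F i) := by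
    rw [inputArray, dif_pos (Fin.is_lt _), Fin.eta, Equiv.symm_apply_apply]
  rw [rowValue, h3, h1, h4, h2 i ⟨0, hd⟩]
  simp only [← Fin.ext_iff, ite_and]
  split_ifs <;> simp

theorem per_eq_sum_rowValue {d n : ℕ} (hd : 0 < d) (R : Tensor d n) :
    per R = ∑ v ∈ Finset.range ((n ^ d) ^ n), ∏ i ∈ Finset.range n,
      rowValue (inputArray R) n d (n ^ d) v i := by
  rw [per_eq_sum_functions hd, Finset.sum_range]
  refine Fintype.sum_equiv ((Equiv.piCongrRight fun _ => finFunctionFinEquiv).trans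
    finFunctionFinEquiv) _ _ fun F => ?_
  rw [Finset.prod_range]
  have : ∀ i : Fin n, rowValue (inputArray R) n d (n ^ d) (((Equiv.piCongrRight fun _ =>
      finFunctionFinEquiv).trans finFunctionFinEquiv) F : Fin ((n ^ d) ^ n)) i =
      if F i ⟨0, hd⟩ = i ∧ ∀ j < i, ∀ k, F i k ≠ F j k then R (F i) else 0 :=
    rowValue_finFunction hd R F
  simp_rw [this, Finset.prod_ite_zero, ← forall_and]
  simp

end Exhaustive

/-! ### The program -/

section Program

variable {x : ℕ → ℂ}

/-- A single size parameter `M` dominates all integers involved, so that the costs of nested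
programs are bounded by monomials in `M`. -/
theorem evalsInt_digitInt_le {a r t m : ℕ} (hr : r < a) (ht : t < a) (hm : m < a) (b : ℕ)
    {s : Store} {M v w k : ℕ} (hv : s.int r = v) (hw : s.int t = w) (hk : s.int m = k)
    (hM : 1 ≤ M) (hvM : v ≤ M) (hkM : k ≤ M) (hpos : 0 < w) :
    EvalsInt x (digitInt a r t m) a b s (v / w ^ k % w) (33 * M ^ 2) := by
  subst hv hw hk
  refine (evalsInt_digitInt hr ht hm b s hpos).le ?_
  calc _ ≤ 2 + (M + 1) * (4 * M + 10) + (2 * M + 1) := by gcongr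
    _ ≤ _ := by nlinarith

/-- Whether rows `i` and `j` differ in index `k`. -/
def clashProg : Prog :=
  .seq (digitInt 10 6 0 9) (.seq (digitInt 11 8 0 9)
    (eqCond 10 11 (constNum 12 7 0) (constNum 12 7 1)))

/-- Integer registers in the exhaustive branch: 0 and 1 hold `n` and `d`; 2 and 3 hold `N = n ^ d`
and `N ^ n`; 4 is the code `v`, 5 the row `i`, 6 its entry address, 7 an earlier row `j`, 8 its
address, 9 the index position `k`. -/
theorem evalsNum_clashProg {s : Store} {M n e f k : ℕ} (h0 : s.int 0 = n) (h6 : s.int 6 = e)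
    (h8 : s.int 8 = f) (h9 : s.int 9 = k) (hn : 0 < n) (hM : 1 ≤ M) (he : e ≤ M) (hf : f ≤ M)
    (hk : k ≤ M) :
    EvalsNum x clashProg 10 7 s (if e / n ^ k % n = f / n ^ k % n then 0 else 1) (70 * M ^ 2) := by
  refine EvalsNum.le (c := 33 * M ^ 2 + (33 * M ^ 2 + (2 + 2))) ?_ (by nlinarith)
  refine (evalsInt_digitInt_le (by omega) (by omega) (by omega) 7 h6 h0 h9 hM he hk hn).letNum
    fun u hu hu1 => ?_
  refine (evalsInt_digitInt_le (by omega) (by omega) (by omega) 7 ((hu.1 8 (by omega)).trans h8)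
    ((hu.1 0 (by omega)).trans h0) ((hu.1 9 (by omega)).trans h9) hM hf hk hn).letNum
    fun v hv hv1 => ?_
  have := evalsNum_eqCond (x := x) (r := 10) (t := 11) (evalsNum_constNum 12 7 0 v)
    (evalsNum_constNum 12 7 1 v)
  rw [hv1, hv.1 10 (by omega), hu1] at this
  simpa using this

/-- Whether rows `i` and `j` have no index in common. -/
def rowPairProg : Prog := .seq (digitInt 8 4 2 7) (prodNum 9 6 1 clashProg)

theorem evalsNum_rowPairProg {s : Store} {M n d N v e j : ℕ} (h0 : s.int 0 = n) (h1 : s.int 1 = d)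
    (h2 : s.int 2 = N) (h4 : s.int 4 = v) (h6 : s.int 6 = e) (h7 : s.int 7 = j)
    (hn : 0 < n) (hN : 0 < N) (hM : 1 ≤ M) (hdM : d ≤ M) (hNM : N ≤ M) (hv : v ≤ M) (he : e ≤ M)
    (hj : j ≤ M) :
    EvalsNum x rowPairProg 8 6 s (∏ k ∈ Finset.range d,
      if e / n ^ k % n = v / N ^ j % N / n ^ k % n then 0 else 1) (185 * M ^ 3) := by
  refine EvalsNum.le (c := 33 * M ^ 2 + (2 + (M + 1) * (70 * M ^ 2 + 5))) ?_ (by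
    have h1 : M ≤ M ^ 2 := Nat.le_self_pow (by omega) M
    have h2 : M ^ 2 ≤ M ^ 3 := Nat.pow_le_pow_right hM (by omega)
    nlinarith)
  refine (evalsInt_digitInt_le (by omega) (by omega) (by omega) 6 h4 h2 h7 hM hv hj hN).letNum
    fun u hu hu1 => ?_
  refine evalsNum_prodNum (by omega) ((hu.1 1 (by omega)).trans h1) hdM _ fun k hk w hw hwk => ?_
  have hf : v / N ^ j % N ≤ M := (Nat.mod_lt _ hN).le.trans hNM
  exact evalsNum_clashProg ((hw.1 0 (by omega)).trans ((hu.1 0 (by omega)).trans h0))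
    ((hw.1 6 (by omega)).trans ((hu.1 6 (by omega)).trans h6))
    ((hw.1 8 (by omega)).trans hu1) hwk hn hM he hf (hk.le.trans hdM)

/-- Whether the first index of row `i` is `i`. -/
def firstIndexProg : Prog :=
  .seq (.instr (.intConst 7 0)) (.seq (digitInt 8 6 0 7)
    (eqCond 8 5 (constNum 9 4 1) (constNum 9 4 0)))

theorem evalsNum_firstIndexProg {s : Store} {M n e i : ℕ} (h0 : s.int 0 = n) (h5 : s.int 5 = i)
    (h6 : s.int 6 = e) (hn : 0 < n) (hM : 1 ≤ M) (he : e ≤ M) :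
    EvalsNum x firstIndexProg 7 4 s (if e / n ^ 0 % n = i then 1 else 0) (38 * M ^ 2) := by
  refine EvalsNum.le (c := 1 + (33 * M ^ 2 + (2 + 2))) ?_ (by nlinarith)
  refine (evalsInt_const 7 4 0 s).letNum fun u hu hu1 => ?_
  refine (evalsInt_digitInt_le (by omega) (by omega) (by omega) 4 ((hu.1 6 (by omega)).trans h6)
    ((hu.1 0 (by omega)).trans h0) hu1 hM he (by omega) hn).letNum fun v hv hv1 => ?_
  have := evalsNum_eqCond (x := x) (r := 8) (t := 5) (evalsNum_constNum 9 4 1 v)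
    (evalsNum_constNum 9 4 0 v)
  rw [hv1, hv.1 5 (by omega), hu.1 5 (by omega), h5] at this
  simpa using this

/-- The contribution of row `i`. -/
def rowProg : Prog :=
  .seq (digitInt 6 4 2 5) (mulNum 3 (.instr (.numRead 3 6))
    (mulNum 4 firstIndexProg (prodNum 7 5 5 rowPairProg)))

theorem evalsNum_rowProg {s : Store} {M n d N v i : ℕ} (h0 : s.int 0 = n) (h1 : s.int 1 = d)
    (h2 : s.int 2 = N) (h4 : s.int 4 = v) (h5 : s.int 5 = i)
    (hn : 0 < n) (hN : 0 < N) (hM : 1 ≤ M) (hdM : d ≤ M) (hNM : N ≤ M) (hv : v ≤ M) (hi : i ≤ M) :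
    EvalsNum x rowProg 6 3 s (rowValue x n d N v i) (456 * M ^ 4) := by
  refine EvalsNum.le (c := 33 * M ^ 2 + (1 + (38 * M ^ 2 + (2 + (M + 1) * (185 * M ^ 3 + 5) + 1)
    + 1))) ?_ (by
    have h1 : M ≤ M ^ 2 := Nat.le_self_pow (by omega) M
    have h2 : M ^ 2 ≤ M ^ 3 := Nat.pow_le_pow_right hM (by omega)
    have h3 : M ^ 3 ≤ M ^ 4 := Nat.pow_le_pow_right hM (by omega)
    nlinarith)
  refine (evalsInt_digitInt_le (by omega) (by omega) (by omega) 3 h4 h2 h5 hM hv hi hN).letNum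
    fun u hu hu1 => ?_
  have he : v / N ^ i % N ≤ M := (Nat.mod_lt _ hN).le.trans hNM
  refine EvalsNum.mulNum (hu1 ▸ evalsNum_read 7 3 6 u) fun u' hu' => ?_
  have g : ∀ r < 6, u'.int r = s.int r := fun r hr =>
    (hu'.1 r (by omega)).trans (hu.1 r (by omega))
  have g6 : u'.int 6 = v / N ^ i % N := (hu'.1 6 (by omega)).trans hu1
  refine (evalsNum_firstIndexProg ((g 0 (by omega)).trans h0) ((g 5 (by omega)).trans h5) g6
    hn hM he).mulNum fun w hw => ?_
  have g' : ∀ r < 6, w.int r = s.int r := fun r hr =>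
    (hw.1 r (by omega)).trans (g r hr)
  refine evalsNum_prodNum (by omega) ((g' 5 (by omega)).trans h5) hi _ fun j hj t ht htj => ?_
  exact evalsNum_rowPairProg ((ht.1 0 (by omega)).trans ((g' 0 (by omega)).trans h0))
    ((ht.1 1 (by omega)).trans ((g' 1 (by omega)).trans h1))
    ((ht.1 2 (by omega)).trans ((g' 2 (by omega)).trans h2))
    ((ht.1 4 (by omega)).trans ((g' 4 (by omega)).trans h4))
    ((ht.1 6 (by omega)).trans ((hw.1 6 (by omega)).trans g6)) htj hn hN hM hdM hNM hv he
    (hj.le.trans hi)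

/-- The exact permanent by exhaustive search. -/
def exhaustiveProg : Prog :=
  .seq (powInt 2 0 1) (.seq (powInt 3 2 0) (sumNum 4 1 3 (prodNum 5 2 0 rowProg)))

theorem evalsNum_exhaustiveProg {s : Store} {M n d : ℕ} (h0 : s.int 0 = n) (h1 : s.int 1 = d)
    (hn : 0 < n) (hnM : n ≤ M) (hdM : d ≤ M) (hVM : (n ^ d) ^ n ≤ M) :
    EvalsNum x exhaustiveProg 2 1 s (∑ v ∈ Finset.range ((n ^ d) ^ n), ∏ i ∈ Finset.range n,
      rowValue x n d (n ^ d) v i) (2000 * M ^ 6) := by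
  have hN : 0 < n ^ d := Nat.pow_pos hn
  have hNM : n ^ d ≤ M := (Nat.le_self_pow hn.ne' _).trans hVM
  have hM : 1 ≤ M := by omega
  refine EvalsNum.le (c := 1 + (M + 1) * (7 * M + 14) + (1 + (M + 1) * (7 * M + 14) +
    (2 + (M + 1) * (2 + (M + 1) * (456 * M ^ 4 + 5) + 5)))) ?_ (by
    have h1 : M ≤ M ^ 2 := Nat.le_self_pow (by omega) M
    have h2 : M ^ 2 ≤ M ^ 3 := Nat.pow_le_pow_right hM (by omega)
    have h3 : M ^ 3 ≤ M ^ 4 := Nat.pow_le_pow_right hM (by omega)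
    have h4 : M ^ 4 ≤ M ^ 5 := Nat.pow_le_pow_right hM (by omega)
    have h5 : M ^ 5 ≤ M ^ 6 := Nat.pow_le_pow_right hM (by omega)
    nlinarith)
  have hp1 := evalsInt_powInt (x := x) (a := 2) (r := 0) (t := 1) (by omega) (by omega) 1 s
  rw [h0, h1] at hp1
  refine (hp1.le (by gcongr)).letNum fun u hu hu2 => ?_
  have hp2 := evalsInt_powInt (x := x) (a := 3) (r := 2) (t := 0) (by omega) (by omega) 1 u
  rw [hu2, hu.1 0 (by omega), h0] at hp2
  refine (hp2.le (by gcongr)).letNum fun w hw hw3 => ?_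
  refine evalsNum_sumNum (by omega) hw3 hVM _ fun v hv t ht htv => ?_
  have g : ∀ r < 2, t.int r = s.int r := fun r hr =>
    (ht.1 r (by omega)).trans ((hw.1 r (by omega)).trans (hu.1 r (by omega)))
  have g2 : t.int 2 = n ^ d := (ht.1 2 (by omega)).trans ((hw.1 2 (by omega)).trans hu2)
  refine evalsNum_prodNum (by omega) ((g 0 (by omega)).trans h0) hnM _ fun i hi q hq hqi => ?_
  exact evalsNum_rowProg ((hq.1 0 (by omega)).trans ((g 0 (by omega)).trans h0))
    ((hq.1 1 (by omega)).trans ((g 1 (by omega)).trans h1))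
    ((hq.1 2 (by omega)).trans g2) ((hq.1 4 (by omega)).trans htv) hqi hn hN hM hdM hNM
    (hv.le.trans hVM) (hi.le.trans hnM)

/-- The average of the first `n ^ 3` entries. -/
def averageProg : Prog := divNum 2 (sumNum 5 2 3 (.instr (.numRead 3 5))) (.instr (.numOfInt 3 3))

/-- The product of `d - 1` factors `n!`. -/
def factorialProg : Prog :=
  .seq (.seq (.instr (.intConst 4 1)) (.instr (.intSub 4 1 4))) (prodNum 5 2 4 (prodNum 6 3 0
    (.seq (.instr (.intConst 7 1)) (.seq (.instr (.intAdd 8 6 7)) (.instr (.numOfInt 4 8))))))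

/-- The estimate of the permanent from the average of the first `n ^ 3` entries. -/
def estimateProg : Prog :=
  .seq (mulInt 2 0 0) (.seq (mulInt 3 2 0) (mulNum 1 (prodNum 4 1 0 averageProg) factorialProg))

theorem evalsNum_averageProg {s : Store} {M N : ℕ} (h3 : s.int 3 = N) (hM : 1 ≤ M)
    (hN : N ≤ M) :
    EvalsNum x averageProg 5 2 s ((∑ a ∈ Finset.range N, x a) / N) (16 * M) := by
  refine EvalsNum.le (c := 2 + (M + 1) * (1 + 5) + (1 + 1)) ?_ (by omega)
  refine EvalsNum.divNum (evalsNum_sumNum (by omega) h3 hN _ fun i _ u _ hu => ?_) fun u hu => ?_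
  · exact hu ▸ evalsNum_read 6 3 5 u
  · have := evalsNum_ofInt (x := x) 5 3 3 u
    rwa [hu.1 3 (by omega), h3] at this

theorem evalsNum_factorialProg {s : Store} {M n d : ℕ} (h0 : s.int 0 = n) (h1 : s.int 1 = d)
    (hM : 1 ≤ M) (hnM : n ≤ M) (hdM : d ≤ M) :
    EvalsNum x factorialProg 4 2 s ((n.factorial : ℂ) ^ (d - 1)) (56 * M ^ 2) := by
  have hval : (n.factorial : ℂ) ^ (d - 1) =
      ∏ _k ∈ Finset.range (d - 1), ∏ i ∈ Finset.range n, ((i + 1 : ℕ) : ℂ) := by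
    rw [Finset.prod_const, Finset.card_range, ← Nat.cast_prod, Finset.prod_range_add_one_eq_factorial]
  rw [hval]
  refine EvalsNum.le (c := 2 + (2 + (M + 1) * (2 + (M + 1) * (3 + 5) + 5))) ?_ (by nlinarith)
  have hp : EvalsInt x (.seq (.instr (.intConst 4 1)) (.instr (.intSub 4 1 4))) 4 2 s (d - 1) 2 :=
    Halts.instr_seq (c := 1) (Halts.instr ⟨by simp [Instr.exec, Store.setInt_int, h1],
      ((Agree.refl 4 2 s).setInt le_rfl _).setInt le_rfl _⟩)
  refine hp.letNum fun u hu hu4 => ?_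
  refine evalsNum_prodNum (by omega) hu4 (by omega) _ fun k _ v hv _ => ?_
  refine evalsNum_prodNum (by omega) ((hv.1 0 (by omega)).trans ((hu.1 0 (by omega)).trans h0))
    hnM _ fun i _ w _ hwi => ?_
  refine (evalsInt_const 7 4 1 w).letNum (c' := 2) fun t ht ht7 => ?_
  have ha := evalsInt_add (x := x) 8 4 6 7 t
  rw [ht7, ht.1 6 (by omega), hwi] at ha
  exact ha.letNum (c' := 1) fun q _ hq => hq ▸ evalsNum_ofInt 9 4 8 q

theorem evalsNum_estimateProg {s : Store} {M n d : ℕ} (h0 : s.int 0 = n) (h1 : s.int 1 = d)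
    (hn : 0 < n) (hnM : n ^ 3 ≤ M) (hdM : d ≤ M) :
    EvalsNum x estimateProg 2 1 s (((∑ a ∈ Finset.range (n ^ 3), x a) / (n ^ 3 : ℕ)) ^ n *
      (n.factorial : ℂ) ^ (d - 1)) (150 * M ^ 2) := by
  have hn1 : n ≤ M := (Nat.le_self_pow (by omega) n).trans hnM
  have hn2 : n * n ≤ M := by
    refine le_trans ?_ hnM
    rw [← sq]; exact Nat.pow_le_pow_right hn (by omega)
  have hM : 1 ≤ M := by omega
  refine EvalsNum.le (c := (7 * M + 8) + ((7 * M + 8) + (2 + (M + 1) * (16 * M + 5) +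
    (56 * M ^ 2 + 1)))) ?_ (by nlinarith)
  have hp1 := evalsInt_mulInt (x := x) (a := 2) (r := 0) (t := 0) (by omega) (by omega) 1 s
  rw [h0] at hp1
  refine (hp1.le (by gcongr)).letNum fun u hu hu2 => ?_
  have hp2 := evalsInt_mulInt (x := x) (a := 3) (r := 2) (t := 0) (by omega) (by omega) 1 u
  rw [hu2, hu.1 0 (by omega), h0, show n * n * n = n ^ 3 by ring] at hp2
  refine (hp2.le (by gcongr)).letNum fun w hw hw3 => ?_
  have g : ∀ r < 2, w.int r = s.int r := fun r hr =>
    (hw.1 r (by omega)).trans (hu.1 r (by omega))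
  have hpow : ((∑ a ∈ Finset.range (n ^ 3), x a) / (n ^ 3 : ℕ)) ^ n =
      ∏ _i ∈ Finset.range n, (∑ a ∈ Finset.range (n ^ 3), x a) / (n ^ 3 : ℕ) := by
    rw [Finset.prod_const, Finset.card_range]
  rw [hpow]
  refine EvalsNum.mulNum (evalsNum_prodNum (by omega) ((g 0 (by omega)).trans h0) hn1 _
    fun i _ t ht _ => ?_) fun t ht => ?_
  · exact evalsNum_averageProg ((ht.1 3 (by omega)).trans hw3) hM hnM
  · exact evalsNum_factorialProg ((ht.1 0 (by omega)).trans ((g 0 (by omega)).trans h0))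
      ((ht.1 1 (by omega)).trans ((g 1 (by omega)).trans h1)) hM hn1 hdM

/-- The whole algorithm. -/
def permanentProg : Prog :=
  .seq (constNum 2 1 1) (.seq (.instr (.numMul 2 0 0)) (.seq (.instr (.numMul 2 2 2))
    (.seq (.instr (.numOfInt 3 0)) (.seq (.instr (.numMul 2 2 3))
      (.seq (.cond (.numLe 1 2) estimateProg exhaustiveProg)
        (.seq (.instr (.numSub 2 2 2)) (.instr (.numAdd 0 1 2))))))))

theorem permanentProg_computes {d n : ℕ} (hd : 0 < d) (hn : 0 < n) (R : Tensor d n) (ε : ℝ) :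
    ∃ T, permanentProg.Computes R ε T (approxPer d n R ε) ∧
      T ≤ if 1 ≤ ε ^ 4 * n then 200 * (n ^ 3 + d) ^ 2 else 2100 * ((n ^ d) ^ n + n + d) ^ 6 := by
  set B := if 1 ≤ ε ^ 4 * (n : ℝ) then 150 * (n ^ 3 + d) ^ 2
    else 2000 * ((n ^ d) ^ n + n + d) ^ 6 with hB
  suffices h : Halts (inputArray R) permanentProg (initStore d n ε)
      (2 + (1 + (1 + (1 + (1 + (1 + B + (1 + 1)))))))
      fun u => u.num 0 = approxPer d n R ε by
    obtain ⟨T, u, h1, h2, h3⟩ := h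
    refine ⟨T, ⟨u, h1, h3⟩, h2.trans ?_⟩
    have e1 : 1 ≤ (n ^ 3 + d) ^ 2 := Nat.one_le_pow _ _ (by omega)
    have e2 : 1 ≤ ((n ^ d) ^ n + n + d) ^ 6 := Nat.one_le_pow _ _ (by omega)
    rw [hB]
    split_ifs <;> omega
  refine (evalsNum_constNum 2 1 1 _).seq fun u hu => ?_
  have hε : u.num 0 = ε := by rw [hu.2.2 0 (by omega)]; simp [initStore]
  have hun : u.int 0 = n := by rw [hu.2.1 0 (by omega)]; simp [initStore]
  have hud : u.int 1 = d := by rw [hu.2.1 1 (by omega)]; simp [initStore]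
  refine Halts.instr_seq (Halts.instr_seq (Halts.instr_seq (Halts.instr_seq ?_)))
  set t := Instr.exec (inputArray R) (Instr.exec (inputArray R) (Instr.exec (inputArray R)
    (Instr.exec (inputArray R) u (.numMul 2 0 0)) (.numMul 2 2 2)) (.numOfInt 3 0)) (.numMul 2 2 3)
    with ht
  have ht0 : t.int 0 = n := by simp [ht, Instr.exec, Store.setNum_int, hun]
  have ht1 : t.int 1 = d := by simp [ht, Instr.exec, Store.setNum_int, hud]
  have htn : t.num 1 = 1 := by simp [ht, Instr.exec, Store.setNum_num, hu.1]
  have htε : t.num 2 = ((ε ^ 4 * n : ℝ) : ℂ) := by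
    simp only [ht, Instr.exec, Store.setNum_num, Store.setNum_int, hε, hun]
    norm_num
    left; ring
  have htest : Test.Holds t (.numLe 1 2) ↔ 1 ≤ ε ^ 4 * n := by
    simp only [Test.Holds, htn, htε, Complex.ofReal_re, Complex.one_re]
  have hmain : Halts (inputArray R) (.cond (.numLe 1 2) estimateProg exhaustiveProg) t (1 + B)
      fun v => v.num 1 = approxPer d n R ε := by
    refine Halts.cond (fun h => ?_) fun h => ?_
    · rw [htest] at h
      rw [hB, if_pos h, approxPer, if_pos h]
      exact (evalsNum_estimateProg ht0 ht1 hn (by omega) (by omega)).mono le_rfl fun _ hv => hv.1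
    · rw [htest] at h
      rw [hB, if_neg h, approxPer, if_neg h, per_eq_sum_rowValue hd]
      exact (evalsNum_exhaustiveProg ht0 ht1 hn (by omega) (by omega) (by omega)).mono le_rfl
        fun _ hv => hv.1
  -- The result is moved to the output register by adding a zero obtained as the difference of a
  -- register with itself.
  refine hmain.seq fun v hv => Halts.instr_seq (Halts.instr ?_)
  simp [Instr.exec, Store.setNum_num, hv]

end Program

/-! ### The running time -/

theorem order_le {C : ℝ} {κ d n : ℕ} (hn : 1 ≤ n) (hd : (d : ℝ) ≤ C * (1 + Real.log n) ^ κ) :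
    d ≤ ⌈|C|⌉₊ * n ^ κ := by
  have hn0 : (0 : ℝ) < n := by exact_mod_cast hn
  have hn1 : (1 : ℝ) ≤ n := by exact_mod_cast hn
  have hlog := Real.log_nonneg hn1
  have h : (d : ℝ) ≤ ⌈|C|⌉₊ * (n : ℝ) ^ κ := by
    calc (d : ℝ) ≤ C * (1 + Real.log n) ^ κ := hd
      _ ≤ ⌈|C|⌉₊ * (1 + Real.log n) ^ κ := by
          gcongr
          exact (le_abs_self C).trans (Nat.le_ceil _)
      _ ≤ ⌈|C|⌉₊ * (n : ℝ) ^ κ := by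
          gcongr
          linarith [Real.log_le_sub_one_of_pos hn0]
  exact_mod_cast h

theorem estimate_time_le {D κ d n : ℕ} (hn : 1 ≤ n) (hd : d ≤ D * n ^ κ) :
    200 * (n ^ 3 + d) ^ 2 ≤ 200 * (1 + D) ^ 2 * n ^ (2 * κ + 6) := by
  have h : n ^ 3 + d ≤ (1 + D) * n ^ (κ + 3) := by
    calc n ^ 3 + d ≤ n ^ (κ + 3) + D * n ^ (κ + 3) := by
          refine Nat.add_le_add (Nat.pow_le_pow_right hn (by omega)) (hd.trans ?_)
          exact Nat.mul_le_mul_left _ (Nat.pow_le_pow_right hn (by omega))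
      _ = _ := by ring
  calc 200 * (n ^ 3 + d) ^ 2 ≤ 200 * ((1 + D) * n ^ (κ + 3)) ^ 2 := by gcongr
    _ = _ := by ring

theorem exhaustive_time_le {D κ d n : ℕ} (hn : 1 ≤ n) (hd : d ≤ D * n ^ κ) :
    ((2100 * ((n ^ d) ^ n + n + d) ^ 6 : ℕ) : ℝ) ≤
      1530900 * Real.exp (6 * (D + 1) * (n : ℝ) ^ (κ + 2)) := by
  have hn1 : (1 : ℝ) ≤ n := by exact_mod_cast hn
  have hd' : (d : ℝ) ≤ D * (n : ℝ) ^ κ := by exact_mod_cast hd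
  have hid : ∀ m : ℕ, (m : ℝ) ≤ Real.exp m := fun m => by linarith [Real.add_one_le_exp (m : ℝ)]
  have hpow : (n : ℝ) ^ κ ≤ (n : ℝ) ^ (κ + 2) := pow_le_pow_right₀ hn1 (by omega)
  have hpow1 : (n : ℝ) ≤ (n : ℝ) ^ (κ + 2) := le_self_pow₀ hn1 (by omega)
  set E := Real.exp ((D + 1) * (n : ℝ) ^ (κ + 2)) with hE
  have h1 : (((n : ℝ) ^ d) ^ n) ≤ E := by
    calc ((n : ℝ) ^ d) ^ n ≤ ((Real.exp n) ^ d) ^ n := by gcongr; exact hid n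
      _ = Real.exp (d * n * n) := by
        rw [← Real.exp_nat_mul, ← Real.exp_nat_mul]; congr 1; ring
      _ ≤ E := by
        apply Real.exp_le_exp.2
        calc (d : ℝ) * n * n ≤ D * (n : ℝ) ^ κ * n * n := by gcongr
          _ = D * (n : ℝ) ^ (κ + 2) := by ring
          _ ≤ (D + 1) * (n : ℝ) ^ (κ + 2) := by gcongr; linarith
  have h2 : (n : ℝ) ≤ E := by
    refine (hid n).trans (Real.exp_le_exp.2 (hpow1.trans ?_))
    have : (0 : ℝ) ≤ D * (n : ℝ) ^ (κ + 2) := by positivity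
    linarith
  have h3 : (d : ℝ) ≤ E := by
    refine (hid d).trans (Real.exp_le_exp.2 (hd'.trans ?_))
    gcongr
    linarith
  calc ((2100 * ((n ^ d) ^ n + n + d) ^ 6 : ℕ) : ℝ)
      = 2100 * (((n : ℝ) ^ d) ^ n + n + d) ^ 6 := by push_cast; rfl
    -- The constant arises as `2100 * 3 ^ 6 = 1530900`.
    _ ≤ 2100 * (E + E + E) ^ 6 := by gcongr
    _ = 1530900 * E ^ 6 := by ring
    _ = _ := by rw [hE, ← Real.exp_nat_mul]; congr 2; push_cast; ring

theorem exists_time_bound (C : ℝ) (κ : ℕ) :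
    ∃ K : ℕ, ∀ d n : ℕ, 1 ≤ n → (d : ℝ) ≤ C * (1 + Real.log n) ^ κ →
      ∀ ε : ℝ, 0 < ε → ε < 1 → ∀ T : ℕ,
        (T ≤ if 1 ≤ ε ^ 4 * n then 200 * (n ^ 3 + d) ^ 2 else 2100 * ((n ^ d) ^ n + n + d) ^ 6) →
        (T : ℝ) ≤ K * (n : ℝ) ^ K * Real.exp ((1 / ε) ^ K) := by
  obtain ⟨D, hD⟩ : ∃ D, D = ⌈|C|⌉₊ := ⟨_, rfl⟩
  set E := 6 * (D + 1) with hE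
  set A := ⌈1530900 * Real.exp E⌉₊ with hA
  -- The sum dominates every constant needed: coefficient and exponent of the polynomial branch, the
  -- factor `A` of the exhaustive one, and the exponent of `1 / ε`.
  refine ⟨200 * (1 + D) ^ 2 + (2 * κ + 6) + A + 4 * (κ + 2 + E), fun d n hn hdC ε hε0 hε1 T hT => ?_⟩
  set K := 200 * (1 + D) ^ 2 + (2 * κ + 6) + A + 4 * (κ + 2 + E) with hK
  have hd := order_le hn hdC
  rw [← hD] at hd
  have hn1 : (1 : ℝ) ≤ n := by exact_mod_cast hn
  have hε : 1 ≤ 1 / ε := by rw [le_div_iff₀ hε0]; linarith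
  have hexp1 : 1 ≤ Real.exp ((1 / ε) ^ K) := Real.one_le_exp (by positivity)
  have hnK : 1 ≤ (n : ℝ) ^ K := one_le_pow₀ hn1
  have hAK : 1530900 * Real.exp E ≤ K := by
    refine (Nat.le_ceil _).trans ?_
    have : A ≤ K := by omega
    exact_mod_cast this
  split_ifs at hT with hb
  · have h1 : T ≤ K * n ^ K := by
      refine (hT.trans (estimate_time_le hn hd)).trans (Nat.mul_le_mul (by omega) ?_)
      exact Nat.pow_le_pow_right hn (by omega)
    have h2 : (T : ℝ) ≤ K * (n : ℝ) ^ K := by exact_mod_cast h1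
    exact h2.trans (le_mul_of_one_le_right (by positivity) hexp1)
  · have h1 : (T : ℝ) ≤ 1530900 * Real.exp (E * (n : ℝ) ^ (κ + 2)) := by
      refine le_trans (by exact_mod_cast hT) ((exhaustive_time_le hn hd).trans (le_of_eq ?_))
      rw [hE]; push_cast; rfl
    -- The constant `E` in the exponent is absorbed by `E ≤ n ^ E`, which needs `n ≥ 2`; for `n = 1`
    -- the whole cost is at most the constant `A`.
    rcases hn.eq_or_lt with rfl | hn2
    · simp only [Nat.cast_one, one_pow, mul_one] at h1 ⊢
      exact (h1.trans hAK).trans (le_mul_of_one_le_right (by positivity) hexp1)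
    · have hE2 : (E : ℝ) ≤ (n : ℝ) ^ E := by
        have : E ≤ n ^ E := (Nat.lt_pow_self hn2).le
        exact_mod_cast this
      have hnε : (n : ℝ) ≤ (1 / ε) ^ 4 := by
        rw [one_div, inv_pow, ← one_div, le_div_iff₀ (by positivity)]
        linarith [not_le.1 hb]
      have h2 : (E : ℝ) * (n : ℝ) ^ (κ + 2) ≤ (1 / ε) ^ K := by
        calc (E : ℝ) * (n : ℝ) ^ (κ + 2) ≤ (n : ℝ) ^ E * (n : ℝ) ^ (κ + 2) := by gcongr
          _ = (n : ℝ) ^ (κ + 2 + E) := by ring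
          _ ≤ ((1 / ε) ^ 4) ^ (κ + 2 + E) := by gcongr
          _ = (1 / ε) ^ (4 * (κ + 2 + E)) := by rw [← pow_mul]
          _ ≤ (1 / ε) ^ K := pow_le_pow_right₀ hε (by omega)
      have hK' : (1530900 : ℝ) ≤ K := by
        refine le_trans ?_ hAK
        have := Real.one_le_exp (x := (E : ℝ)) (by positivity)
        linarith
      calc (T : ℝ) ≤ 1530900 * Real.exp (E * (n : ℝ) ^ (κ + 2)) := h1
        _ ≤ K * Real.exp ((1 / ε) ^ K) := by gcongr
        _ ≤ K * (n : ℝ) ^ K * Real.exp ((1 / ε) ^ K) := by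
          gcongr
          exact le_mul_of_one_le_right (by positivity) hnK

end TensorPermanent

theorem mainTheorem3 (c : ℝ) (hc_pos : 0 < c) (hc_lt : c < 1 / 8) :
    ∃ (prog : TensorPermanent.Prog)
      (P : (d n : ℕ) → TensorPermanent.Tensor d n → ℝ → ℂ),
      ∀ (C : ℝ) (κ : ℕ),
        -- `prog` computes `P`, in time polynomial in `n` and at most exponential in `1 / ε`
        (∃ K : ℕ, ∀ d n : ℕ, 1 ≤ n → 3 ≤ d → (d : ℝ) ≤ C * (1 + Real.log n) ^ κ →
          ∀ (R : TensorPermanent.Tensor d n) (ε : ℝ), 0 < ε → ε < 1 →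
            ∃ T : ℕ, prog.Computes R ε T (P d n R ε) ∧
              (T : ℝ) ≤ K * (n : ℝ) ^ K * Real.exp ((1 / ε) ^ K)) ∧
        -- `P` approximates the permanent, with failure probability `o(1)`
        (∀ M : ℝ, ∃ δ : ℕ → ℝ, Tendsto δ atTop (𝓝 0) ∧
          ∀ d n : ℕ, 1 ≤ n → 3 ≤ d → (d : ℝ) ≤ C * (1 + Real.log n) ^ κ →
            ∀ (μ : ℂ) (ν : Measure ℂ), TensorPermanent.IsEntryDistribution μ ν →
              ∫ x, ‖x - μ‖ ^ 3 ∂ν ≤ M →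
              (Real.log n / ((d : ℝ) - 1) ^ 6) ^ (-c) ≤ ‖μ‖ →
              ∀ ε : ℝ, 0 < ε → ε < 1 →
                TensorPermanent.tensorDistribution ν d n
                    {R | ¬ (TensorPermanent.per R ≠ 0 ∧
                      ‖1 - P d n R ε / TensorPermanent.per R‖ ≤ ε)}
                  ≤ ENNReal.ofReal (δ n)) := by
  refine ⟨TensorPermanent.permanentProg, TensorPermanent.approxPer, fun C κ => ⟨?_, fun _ => ?_⟩⟩
  · obtain ⟨K, hK⟩ := TensorPermanent.exists_time_bound C κ
    refine ⟨K, fun d n hn hd hdC R ε hε0 hε1 => ?_⟩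
    obtain ⟨T, h1, h2⟩ := TensorPermanent.permanentProg_computes (by omega) hn R ε
    exact ⟨T, h1, hK d n hn hdC ε hε0 hε1 T h2⟩
  · exact ⟨TensorPermanent.failureBound, TensorPermanent.tendsto_failureBound,
      fun d n _ hd _ μ ν hν _ hμ ε hε0 hε1 => hν.failure_le_failureBound hc_pos hc_lt hd hμ hε0 hε1⟩
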